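/- For a finite group $G$, let $o(a)$ denote the order of an element $a\in G$, and let $$h_m(G)=\frac{|G|}{\sum_{a\in G}\frac{1}{o(a)}}$$ be the harmonic mean of the element orders of $G$. Let $p$ be a prime and let $G$ be a nontrivial finite $p$-group. Then $h_m(G)\in\mathbb{N}$ if and only if either $G$ is cyclic of order $p^{\sum_{i=1}^{s}p^i}=p^{\,p+p^2+\cdots+p^s}$ for some integer $s\geq 1$, or $G\cong D_8$, where $D_8$ is the dihedral group of order $8$. -/

import Mathlib

/-- The sum of the inverses of the element orders of a finite group. -/
noncomputable def sumInvOrders (G : Type*) [Group G] [Fintype G] : ℚ :=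
  ∑ a : G, 1 / (orderOf a : ℚ)

/-- The harmonic mean of the element orders of a finite group. -/
noncomputable def harmonicMeanOrders (G : Type*) [Group G] [Fintype G] : ℚ :=
  (Fintype.card G : ℚ) / sumInvOrders G

/-!
Write `S` for the sum of the inverse orders of the `p`-group `G`. For `G` cyclic of order `p ^ n`
one has `S = (p + n (p - 1)) / p`, so the harmonic mean is integral exactly when `p + n (p - 1)` is
a power of `p`, that is, when `n = p + p ^ 2 + ... + p ^ s`. In general `p * S` is
an integer greater than one, and the harmonic mean is not integral as soon as `p * S` is prime to `p`
(`harmonicMeanOrders_ne_natCast_of_sum_eq`).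

Suppose that `G` has a normal elementary abelian subgroup `E` of order `p ^ 2`
(`IsNormalRankTwo`). It contributes `(p ^ 2 + p - 1) / p` to `S`. A set of cosets of `E` which is
closed under passing to generators of the same cyclic subgroup of `G ⧸ E`, and on each of which the
order is constant, contributes an integer (`exists_int_sum_inv_orderOf`). Since commutators with `E`
are central, the order is constant on every coset other than `E` when `p` is odd, and `p * S` is
prime to `p`. When `p = 2`, the exceptional cosets are those of elements `g` not centralising `E`
with `g ^ 2 ∈ E`; half of such a coset has order two and half has order four. The number of
exceptional cosets is even, because an element of order two of `C(E) / E` central in `G ⧸ E`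
permutes them in pairs, unless `C(E) = E`, which leaves only the dihedral group of order eight.

To find `E`, take a maximal cyclic normal subgroup `⟨a⟩` of the noncyclic group `G`
(`exists_isNormalRankTwo`). If `p` is odd, `E` always exists. If `p = 2` and `E` does not exist,
then `⟨a⟩` has index two and the other elements act on it by an exponent congruent to `3` modulo `4`
(`isCyclic_or_exists_isNormalRankTwo_or`). Then `S` is one of three explicit values, and integrality
of the harmonic mean again leaves only the dihedral group of order eight
(`nonempty_mulEquiv_dihedralGroup_of_index_two`).
-/

open Subgroup

/-! ### Sums of inverse orders and integrality -/

theorem one_le_sumInvOrders (G : Type*) [Group G] [Fintype G] : 1 ≤ sumInvOrders G := by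
  have h := Finset.single_le_sum (f := fun a : G => 1 / (orderOf a : ℚ)) (s := Finset.univ)
    (fun a _ => by positivity) (Finset.mem_univ 1)
  simpa [sumInvOrders] using h

theorem sumInvOrders_congr {G H : Type*} [Group G] [Fintype G] [Group H] [Fintype H] (e : G ≃* H) :
    sumInvOrders G = sumInvOrders H :=
  Fintype.sum_equiv e.toEquiv _ _ fun a => by
    simp [MulEquiv.orderOf_eq e a]

theorem harmonicMeanOrders_congr {G H : Type*} [Group G] [Fintype G] [Group H] [Fintype H]
    (e : G ≃* H) : harmonicMeanOrders G = harmonicMeanOrders H := by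
  rw [harmonicMeanOrders, harmonicMeanOrders, sumInvOrders_congr e, Fintype.card_congr e.toEquiv]

theorem harmonicMeanOrders_dihedralGroup_four :
    harmonicMeanOrders (DihedralGroup 4) = 2 := by
  have h : sumInvOrders (DihedralGroup 4) = 4 := by
    rw [sumInvOrders, Fintype.sum_equiv DihedralGroup.equivSum _
      (Sum.elim (fun i : ZMod 4 => 1 / ((4 / Nat.gcd 4 i.val : ℕ) : ℚ)) fun _ => 1 / 2)]
    · rw [Fintype.sum_sum_type]
      have : ∀ f : ZMod 4 → ℚ, ∑ i, f i = f 0 + f 1 + f 2 + f 3 := fun f => Fin.sum_univ_four f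
      simp only [Sum.elim_inl, Sum.elim_inr, this]
      have h0 : (0 : ZMod 4).val = 0 := rfl
      have h1 : (1 : ZMod 4).val = 1 := rfl
      have h2 : (2 : ZMod 4).val = 2 := rfl
      have h3 : (3 : ZMod 4).val = 3 := rfl
      rw [h0, h1, h2, h3]
      norm_num1
    · rintro (i | i)
      · simp [DihedralGroup.orderOf_r, DihedralGroup.equivSum]
      · simp [DihedralGroup.orderOf_sr, DihedralGroup.equivSum]
  rw [harmonicMeanOrders, h, DihedralGroup.card]
  norm_num

/-- If the sum of the inverse orders has denominator exactly `p`, then its numerator is coprime to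
`p` and exceeds `1`, so it cannot divide `p * |G|`. -/
theorem harmonicMeanOrders_ne_natCast_of_sum_eq {G : Type*} [Group G] [Fintype G] {p : ℕ}
    (hp : p.Prime) (hG : IsPGroup p G) {q : ℤ} (hq : sumInvOrders G = q / p)
    (hpq : ¬ (p : ℤ) ∣ q) (k : ℕ) : harmonicMeanOrders G ≠ k := by
  intro h
  have := Fact.mk hp
  obtain ⟨n, hn⟩ := IsPGroup.iff_card.1 hG
  have hS := one_le_sumInvOrders G
  have hp0 : (0 : ℚ) < p := by exact_mod_cast hp.pos
  have hle : (p : ℚ) ≤ q := by rw [hq, le_div_iff₀ hp0] at hS; linarith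
  have hle' : (p : ℤ) ≤ q := by exact_mod_cast hle
  rw [harmonicMeanOrders, div_eq_iff (by linarith), hq, Fintype.card_eq_nat_card, hn] at h
  have h2 : (p : ℚ) ^ (n + 1) = k * q := by
    field_simp at h
    push_cast at h
    rw [pow_succ, ← h]
  have h3 : (p : ℤ) ^ (n + 1) = k * q := by exact_mod_cast h2
  have hcop : IsCoprime q ((p : ℤ) ^ (n + 1)) :=
    (((Nat.prime_iff_prime_int.1 hp).coprime_iff_not_dvd.2 hpq).symm).pow_right
  have hu : IsUnit q := hcop.isUnit_of_dvd' dvd_rfl ⟨k, by rw [h3]; ring⟩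
  rcases Int.isUnit_iff.1 hu with h | h <;> have := hp.two_le <;> omega

/-- Elements of a subgroup have the same order in the subgroup and in the group. -/
theorem sum_mem_inv_orderOf {G : Type*} [Group G] [Fintype G] (H : Subgroup G)
    [DecidablePred (· ∈ H)] [Fintype H] :
    ∑ g with g ∈ H, 1 / (orderOf g : ℚ) = sumInvOrders H := by
  rw [sumInvOrders, Finset.sum_subtype (p := (· ∈ H)) (F := ‹_›) _ (by simp)]
  simp

theorem sumInvOrders_of_isCyclic {G : Type*} [Group G] [Fintype G] [IsCyclic G] {p n : ℕ}
    (hp : p.Prime) (hn : Nat.card G = p ^ n) :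
    sumInvOrders G = 1 + n * (p - 1) / p := by
  classical
  have hmaps : ∀ g ∈ (Finset.univ : Finset G), orderOf g ∈ (p ^ n).divisors := fun g _ =>
    Nat.mem_divisors.2 ⟨hn ▸ orderOf_dvd_natCard g, pow_ne_zero _ hp.ne_zero⟩
  rw [sumInvOrders, ← Finset.sum_fiberwise_of_maps_to hmaps]
  have hfib : ∀ d ∈ (p ^ n).divisors,
      ∑ g : G with orderOf g = d, 1 / (orderOf g : ℚ) = Nat.totient d / d := by
    intro d hd
    rw [Finset.sum_congr rfl (g := fun _ => 1 / (d : ℚ)) (by simp +contextual), Finset.sum_const,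
      IsCyclic.card_orderOf_eq_totient
        (by rw [Fintype.card_eq_nat_card, hn]; exact Nat.dvd_of_mem_divisors hd)]
    simp [div_eq_mul_inv]
  rw [Finset.sum_congr rfl hfib, Nat.sum_divisors_prime_pow hp, Finset.sum_range_succ']
  have hp0 : (p : ℚ) ≠ 0 := by exact_mod_cast hp.ne_zero
  have hterm : ∀ i ∈ Finset.range n,
      ((p ^ (i + 1)).totient : ℚ) / ((p ^ (i + 1) : ℕ) : ℚ) = (p - 1) / p := by
    intro i _
    rw [Nat.totient_prime_pow_succ hp]
    push_cast [Nat.cast_sub hp.one_le]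
    field_simp
    ring
  rw [Finset.sum_congr rfl hterm]
  simp
  ring

theorem pred_mul_sum_Icc_pow (p s : ℕ) :
    ((p : ℤ) - 1) * ∑ i ∈ Finset.Icc 1 s, (p : ℤ) ^ i = (p : ℤ) ^ (s + 1) - p := by
  induction s with
  | zero => simp
  | succ s ih =>
    rw [Finset.sum_Icc_succ_top (by omega), mul_add, ih]
    ring

theorem sum_Icc_pow_ge (p s : ℕ) (hp : 1 ≤ p) : s ≤ ∑ i ∈ Finset.Icc 1 s, p ^ i := by
  calc s = ∑ i ∈ Finset.Icc 1 s, 1 := by simp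
    _ ≤ _ := Finset.sum_le_sum fun i _ => Nat.one_le_pow _ _ hp

theorem harmonicMeanOrders_isCyclic_iff {G : Type*} [Group G] [Fintype G] [Nontrivial G]
    [IsCyclic G] {p : ℕ} (hp : p.Prime) (hG : IsPGroup p G) :
    (∃ k : ℕ, harmonicMeanOrders G = k) ↔
      ∃ s : ℕ, 1 ≤ s ∧ Fintype.card G = p ^ ∑ i ∈ Finset.Icc 1 s, p ^ i := by
  have := Fact.mk hp
  obtain ⟨n, hn0, hn⟩ := (IsPGroup.nontrivial_iff_card hG).1 ‹_›
  have hp0 : (p : ℚ) ≠ 0 := by exact_mod_cast hp.ne_zero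
  have hp2 := hp.two_le
  have hp2' : (2 : ℚ) ≤ p := by exact_mod_cast hp2
  have hpos : (0 : ℚ) < p + n * (p - 1) := by
    have : (0 : ℚ) ≤ n * (p - 1) := mul_nonneg (by positivity) (by linarith)
    linarith
  have hh : harmonicMeanOrders G = (p : ℚ) ^ (n + 1) / (p + n * (p - 1)) := by
    have hS : sumInvOrders G = (p + n * (p - 1)) / p := by
      rw [sumInvOrders_of_isCyclic hp hn]; field_simp
    rw [harmonicMeanOrders, hS, Fintype.card_eq_nat_card, hn, pow_succ]
    push_cast
    field_simp
  have hinj : ∀ m, Fintype.card G = p ^ m ↔ n = m := fun m => by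
    rw [Fintype.card_eq_nat_card, hn]
    exact (Nat.pow_right_injective hp2).eq_iff
  simp only [hinj]
  constructor
  · rintro ⟨k, hk⟩
    rw [hh, div_eq_iff hpos.ne'] at hk
    have hk' : p ^ (n + 1) = k * (p + n * (p - 1)) := by
      have : ((p - 1 : ℕ) : ℚ) = p - 1 := by push_cast [Nat.cast_sub hp.one_le]; rfl
      rw [← this] at hk
      exact_mod_cast hk
    obtain ⟨j, -, hj⟩ : ∃ j ≤ n + 1, p + n * (p - 1) = p ^ j :=
      (Nat.dvd_prime_pow hp).1 ⟨k, hk'.trans (mul_comm _ _)⟩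
    obtain ⟨m, hm⟩ : ∃ m, p = m + 2 := ⟨p - 2, by omega⟩
    have hj1 : 2 ≤ j := by
      -- `p + n * (p - 1)` exceeds `p`, because `n` is positive.
      have h1 : p ^ 1 < p ^ j := by
        rw [← hj, pow_one]
        exact Nat.lt_add_of_pos_right (Nat.mul_pos hn0 (by omega))
      exact (Nat.pow_lt_pow_iff_right (by omega)).1 h1
    refine ⟨j - 1, by omega, ?_⟩
    have h1 := pred_mul_sum_Icc_pow p (j - 1)
    rw [Nat.sub_add_cancel (by omega)] at h1
    have h2 : (p : ℤ) + n * (p - 1) = (p : ℤ) ^ j := by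
      have : ((p - 1 : ℕ) : ℤ) = p - 1 := by push_cast [Nat.cast_sub hp.one_le]; rfl
      rw [← this]; exact_mod_cast hj
    have h3 : ((p : ℤ) - 1) * n = (p - 1) * ∑ i ∈ Finset.Icc 1 (j - 1), (p : ℤ) ^ i := by
      rw [h1]; linarith
    have h4 := mul_left_cancel₀ (by omega) h3
    exact_mod_cast h4
  · rintro ⟨s, hs, hns⟩
    have hle : s ≤ n := hns ▸ sum_Icc_pow_ge p s hp.one_le
    have h1 := pred_mul_sum_Icc_pow p s
    have h2 : (p : ℚ) + n * (p - 1) = (p : ℚ) ^ (s + 1) := by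
      have hns' : (n : ℤ) = ∑ i ∈ Finset.Icc 1 s, (p : ℤ) ^ i := by rw [hns]; push_cast; rfl
      rw [← hns'] at h1
      have : (p : ℤ) + n * (p - 1) = (p : ℤ) ^ (s + 1) := by linarith
      exact_mod_cast this
    refine ⟨p ^ (n - s), ?_⟩
    rw [hh, h2, div_eq_iff (pow_ne_zero _ hp0)]
    push_cast
    rw [← pow_add]
    congr 1
    omega

/-! ### Sums over unions of cosets -/

theorem orderOf_eq_of_zpowers_eq {G : Type*} [Group G] {g h : G} (hgh : zpowers g = zpowers h) :
    orderOf g = orderOf h := by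
  rw [← Nat.card_zpowers, hgh, Nat.card_zpowers]

theorem card_zpowers_eq_totient {G : Type*} [Group G] [Finite G] (y : G) :
    Nat.card {x : G | zpowers x = zpowers y} = (orderOf y).totient := by
  classical
  have := Fintype.ofFinite G
  rw [← IsCyclic.card_orderOf_eq_totient (α := zpowers y) (Fintype.card_zpowers (x := y)).symm.dvd,
    Set.coe_ofPred, Nat.card_eq_fintype_card, Fintype.card_subtype]
  refine Finset.card_bij' (fun x _ => if h : x ∈ zpowers y then ⟨x, h⟩ else 1) (fun x _ => x)
    ?_ ?_ ?_ ?_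
  · intro x hx
    have hx' : zpowers x = zpowers y := by simpa using hx
    have hm : x ∈ zpowers y := hx' ▸ mem_zpowers x
    simp only [dif_pos hm]
    simpa [Subgroup.orderOf_mk] using orderOf_eq_of_zpowers_eq hx'
  · intro x hx
    have hx' : orderOf (x : G) = orderOf y := by simpa using hx
    have hle : zpowers (x : G) ≤ zpowers y := zpowers_le.2 x.2
    have := Subgroup.eq_of_le_of_card_ge hle
      (by rw [Nat.card_zpowers, Nat.card_zpowers, hx'])
    simpa using this
  · intro x hx
    have hx' : zpowers x = zpowers y := by simpa using hx
    have hm : x ∈ zpowers y := hx' ▸ mem_zpowers x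
    simp [hm]
  · intro x hx
    simp

/-- Grouping the elements of `X` by the cyclic subgroup of `G ⧸ E` they generate, a group with
subgroup of order `p ^ m` has `p ^ 2 * φ (p ^ m)` elements of one common order dividing
`p ^ (m + 1)`, so it contributes an integer. -/
theorem exists_int_sum_inv_orderOf {G : Type*} [Group G] [Fintype G] {p : ℕ} (hp : p.Prime)
    (hG : IsPGroup p G) (E : Subgroup G) [E.Normal] (hE : Nat.card E = p ^ 2)
    (hexp : ∀ e ∈ E, e ^ p = 1) (X : Finset G) (hXE : ∀ g ∈ X, g ∉ E)
    (hX : ∀ g ∈ X, ∀ h : G, zpowers (g : G ⧸ E) = zpowers (h : G ⧸ E) → h ∈ X)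
    (hord : ∀ g ∈ X, ∀ e ∈ E, orderOf (g * e) = orderOf g) :
    ∃ N : ℤ, ∑ g ∈ X, 1 / (orderOf g : ℚ) = N := by
  classical
  have := Fact.mk hp
  rw [← Finset.sum_fiberwise_of_maps_to (g := fun g : G => zpowers (g : G ⧸ E))
    (t := X.image fun g : G => zpowers (g : G ⧸ E)) fun g hg => Finset.mem_image_of_mem _ hg]
  refine Finset.sum_induction _ (fun q : ℚ => ∃ N : ℤ, q = N) ?_ ⟨0, by simp⟩ ?_
  · rintro _ _ ⟨a, rfl⟩ ⟨b, rfl⟩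
    exact ⟨a + b, by push_cast; rfl⟩
  intro K hK
  obtain ⟨g, hg, rfl⟩ := Finset.mem_image.1 hK
  have hne : (g : G ⧸ E) ≠ 1 := fun h => hXE g hg ((QuotientGroup.eq_one_iff g).1 h)
  obtain ⟨m, hm⟩ := IsPGroup.iff_orderOf.1 (hG.to_quotient E) (g : G ⧸ E)
  have hm0 : m ≠ 0 := by
    rintro rfl
    exact hne (orderOf_eq_one_iff.1 (by simpa using hm))
  obtain ⟨k, rfl⟩ := Nat.exists_eq_succ_of_ne_zero hm0
  have hconst : ∀ h ∈ X.filter (fun h : G => zpowers (h : G ⧸ E) = zpowers (g : G ⧸ E)),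
      1 / (orderOf h : ℚ) = 1 / (orderOf g : ℚ) := by
    intro h hh
    obtain ⟨hhX, hz⟩ := Finset.mem_filter.1 hh
    have hmem : (h : G ⧸ E) ∈ zpowers (g : G ⧸ E) := hz ▸ mem_zpowers _
    obtain ⟨i, hi⟩ := mem_zpowers_iff_mem_range_orderOf.1 hmem |> Finset.mem_image.1
    have hi2 : ((g ^ i : G) : G ⧸ E) = h := hi.2
    -- The exponent `i` is prime to `p` since both cosets generate the same nontrivial subgroup.
    have hcop : i.gcd (orderOf (g : G ⧸ E)) = 1 := by
      rw [← mem_zpowers_pow_iff, hi.2, hz]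
      exact mem_zpowers _
    have hcop' : Nat.Coprime p i := by
      rw [hm] at hcop
      exact ((Nat.coprime_pow_right_iff (Nat.succ_pos k) _ _).1 hcop).symm
    have ho : orderOf (g ^ i) = orderOf g :=
      Nat.Coprime.orderOf_pow (hG.orderOf_coprime hcop' g)
    have hgX : g ^ i ∈ X := hX h hhX _ (by rw [hi2])
    have := hord _ hgX ((g ^ i)⁻¹ * h) (QuotientGroup.eq.1 hi2)
    rw [mul_inv_cancel_left] at this
    rw [this, ho]
  rw [Finset.sum_congr rfl hconst, Finset.sum_const]
  have hcard : (X.filter (fun h : G => zpowers (h : G ⧸ E) = zpowers (g : G ⧸ E))).card =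
      p ^ 2 * (p ^ (k + 1)).totient := by
    rw [← hE, ← hm, ← card_zpowers_eq_totient, ← QuotientGroup.card_preimage_mk]
    refine (Nat.subtype_card _ fun h => ?_).symm
    rw [Finset.mem_filter]
    exact ⟨fun hh => hh.2, fun hh => ⟨hX g hg h (Eq.symm hh), hh⟩⟩
  obtain ⟨j, hj⟩ := IsPGroup.iff_orderOf.1 hG g
  have hjk : j ≤ k + 2 := by
    have h1 : g ^ p ^ (k + 1) ∈ E := by
      rw [← QuotientGroup.eq_one_iff, QuotientGroup.mk_pow, ← hm, pow_orderOf_eq_one]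
    have h2 : g ^ p ^ (k + 2) = 1 := by
      rw [pow_succ, pow_mul]
      exact hexp _ h1
    have h3 := orderOf_dvd_of_pow_eq_one h2
    rw [hj] at h3
    exact (Nat.pow_dvd_pow_iff_le_right hp.one_lt).1 h3
  refine ⟨p ^ (k + 2 - j) * (p - 1), ?_⟩
  have hp0 : (p : ℚ) ≠ 0 := by exact_mod_cast hp.ne_zero
  obtain ⟨l, hl⟩ := Nat.exists_eq_add_of_le hjk
  have hl' : k + 2 - j = l := by omega
  rw [hcard, hj, hl', Nat.totient_prime_pow_succ hp, nsmul_eq_mul]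
  push_cast [Nat.cast_sub hp.one_le]
  rw [mul_one_div, div_eq_iff (pow_ne_zero _ hp0)]
  calc (p : ℚ) ^ 2 * (p ^ k * (p - 1)) = p ^ (k + 2) * (p - 1) := by ring
    _ = _ := by rw [hl]; ring

/-! ### A normal elementary abelian subgroup of rank two -/

/-- For a prime `p`, the elements `z` and `x` generate a normal elementary abelian subgroup of order
`p ^ 2` in which `z` is central in `G`. The field `conj` says that every commutator of `x` with an
element of `G` lies in `⟨z⟩`. -/
structure IsNormalRankTwo {G : Type*} [Group G] (p : ℕ) (z x : G) : Prop where
  orderOf_eq : orderOf z = p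
  commute : ∀ g, Commute z g
  notMem : x ∉ zpowers z
  pow_eq_one : x ^ p = 1
  conj : ∀ g, ∃ c ∈ zpowers z, x * g = g * x * c

/-- The product formula `(g e) ^ n = g ^ n e ^ n c ^ (n choose 2)` for a central commutator `c`. -/
theorem mul_pow_of_mul_comm_mul {G : Type*} [Group G] {g e c : G} (h : e * g = g * e * c)
    (hc : ∀ y, Commute c y) (n : ℕ) : (g * e) ^ n = g ^ n * e ^ n * c ^ n.choose 2 := by
  have hswap : ∀ n : ℕ, e ^ n * g = g * e ^ n * c ^ n := by
    intro n
    induction n with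
    | zero => simp
    | succ n ih =>
      calc e ^ (n + 1) * g = e ^ n * (e * g) := by rw [pow_succ, mul_assoc]
        _ = (e ^ n * g) * e * c := by rw [h]; simp only [mul_assoc]
        _ = g * e ^ n * (c ^ n * e) * c := by rw [ih]; simp only [mul_assoc]
        _ = g * e ^ n * (e * c ^ n) * c := by rw [((hc e).pow_left n).eq]
        _ = g * e ^ (n + 1) * c ^ (n + 1) := by simp only [pow_succ, mul_assoc]
  induction n with
  | zero => simp
  | succ n ih =>
    rw [pow_succ, ih, Nat.choose_succ_succ' n 1, Nat.choose_one_right]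
    calc g ^ n * e ^ n * c ^ n.choose 2 * (g * e)
        = g ^ n * e ^ n * (c ^ n.choose 2 * (g * e)) := by simp only [mul_assoc]
      _ = g ^ n * e ^ n * ((g * e) * c ^ n.choose 2) := by rw [((hc (g * e)).pow_left _).eq]
      _ = g ^ n * (e ^ n * g) * e * c ^ n.choose 2 := by simp only [mul_assoc]
      _ = g ^ n * g * e ^ n * (c ^ n * e) * c ^ n.choose 2 := by
        rw [hswap]; simp only [mul_assoc]
      _ = g ^ n * g * e ^ n * (e * c ^ n) * c ^ n.choose 2 := by rw [((hc e).pow_left n).eq]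
      _ = g ^ (n + 1) * e ^ (n + 1) * c ^ (n + n.choose 2) := by
        simp only [pow_succ, pow_add, mul_assoc]

namespace IsNormalRankTwo

variable {G : Type*} [Group G] {p : ℕ} {z x : G}

theorem commute_of_mem (h : IsNormalRankTwo p z x) {c : G} (hc : c ∈ zpowers z) (g : G) :
    Commute c g := by
  obtain ⟨i, rfl⟩ := mem_zpowers_iff.1 hc
  exact (h.commute g).zpow_left i

theorem normal_zpowers (h : IsNormalRankTwo p z x) : (zpowers z).Normal :=
  ⟨fun c hc g => by rwa [← (h.commute_of_mem hc g).eq, mul_inv_cancel_right]⟩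

theorem pow_eq_one_of_mem_zpowers (h : IsNormalRankTwo p z x) {c : G} (hc : c ∈ zpowers z) :
    c ^ p = 1 := by
  rw [← h.orderOf_eq, ← Nat.card_zpowers]
  exact congrArg Subtype.val (pow_card_eq_one' (x := (⟨c, hc⟩ : zpowers z)))

theorem normal_sup (h : IsNormalRankTwo p z x) : (zpowers x ⊔ zpowers z).Normal := by
  have := h.normal_zpowers
  refine ⟨fun e he g => ?_⟩
  obtain ⟨y, hy, c, hc, rfl⟩ := mem_sup_of_normal_right.1 he
  obtain ⟨i, rfl⟩ := mem_zpowers_iff.1 hy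
  have hx : g * x * g⁻¹ ∈ zpowers x ⊔ zpowers z := by
    obtain ⟨d, hd, hxd⟩ := h.conj g⁻¹
    have : g * x * g⁻¹ = x * d := by rw [mul_assoc, hxd]; group
    rw [this]
    exact mul_mem (mem_sup_left (mem_zpowers x)) (mem_sup_right hd)
  have : g * (x ^ i * c) * g⁻¹ = (g * x * g⁻¹) ^ i * c := by
    rw [conj_zpow, mul_assoc g, mul_assoc (x ^ i), (h.commute_of_mem hc g⁻¹).eq]
    simp only [mul_assoc]
  rw [this]
  exact mul_mem (zpow_mem hx i) (mem_sup_right hc)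

theorem orderOf_eq' (h : IsNormalRankTwo p z x) (hp : p.Prime) : orderOf x = p :=
  have := Fact.mk hp
  orderOf_eq_prime h.pow_eq_one fun hx => h.notMem (hx ▸ one_mem _)

theorem card_sup (h : IsNormalRankTwo p z x) (hp : p.Prime) :
    Nat.card (zpowers x ⊔ zpowers z : Subgroup G) = p ^ 2 := by
  have := h.normal_zpowers
  have := Fact.mk hp
  have hinf : zpowers z ⊓ zpowers x = ⊥ := by
    have hdvd : Nat.card (zpowers z ⊓ zpowers x : Subgroup G) ∣ p := by
      rw [← h.orderOf_eq' hp, ← Nat.card_zpowers]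
      exact card_dvd_of_le inf_le_right
    rcases (Nat.dvd_prime hp).1 hdvd with h1 | h1
    · exact card_eq_one.1 h1
    · have hf : Finite (zpowers x) := Nat.finite_of_card_ne_zero
        (by rw [Nat.card_zpowers, h.orderOf_eq' hp]; exact hp.ne_zero)
      have h2 : zpowers z ⊓ zpowers x = zpowers x := eq_of_le_of_card_ge inf_le_right
        (by rw [h1, Nat.card_zpowers, h.orderOf_eq' hp])
      exact absurd (inf_eq_right.1 h2 (mem_zpowers x)) h.notMem
  have h1 := relIndex_mul_relIndex ⊥ (zpowers z) (zpowers x ⊔ zpowers z) bot_le le_sup_right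
  rw [relIndex_bot_left, relIndex_bot_left, relIndex_sup_right, ← inf_relIndex_right, hinf,
    relIndex_bot_left, Nat.card_zpowers, Nat.card_zpowers, h.orderOf_eq, h.orderOf_eq' hp] at h1
  rw [← h1, sq]

theorem exists_of_mem_sup (h : IsNormalRankTwo p z x) {e : G} (he : e ∈ zpowers x ⊔ zpowers z) :
    ∃ i : ℤ, ∃ c ∈ zpowers z, e = x ^ i * c := by
  have := h.normal_zpowers
  obtain ⟨y, hy, c, hc, rfl⟩ := mem_sup_of_normal_right.1 he
  obtain ⟨i, rfl⟩ := mem_zpowers_iff.1 hy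
  exact ⟨i, c, hc, rfl⟩

theorem pow_eq_one_of_mem_sup (h : IsNormalRankTwo p z x) {e : G}
    (he : e ∈ zpowers x ⊔ zpowers z) : e ^ p = 1 := by
  obtain ⟨i, c, hc, rfl⟩ := h.exists_of_mem_sup he
  rw [(h.commute_of_mem hc _).symm.mul_pow, h.pow_eq_one_of_mem_zpowers hc, mul_one, ← zpow_natCast,
    zpow_comm, zpow_natCast, h.pow_eq_one, one_zpow]

theorem exists_mul_comm_mul (h : IsNormalRankTwo p z x) {e : G}
    (he : e ∈ zpowers x ⊔ zpowers z) (g : G) : ∃ c ∈ zpowers z, e * g = g * e * c := by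
  obtain ⟨i, c, hc, rfl⟩ := h.exists_of_mem_sup he
  obtain ⟨d, hd, hxg⟩ := h.conj g
  have hconj : g⁻¹ * x * g = x * d := by rw [mul_assoc, hxg]; group
  have h1 : g⁻¹ * x ^ i * g = x ^ i * d ^ i := by
    rw [← (h.commute_of_mem hd x).symm.mul_zpow, ← hconj]
    simpa using (conj_zpow (a := g⁻¹) (b := x) (i := i)).symm
  refine ⟨d ^ i, zpow_mem hd i, ?_⟩
  calc x ^ i * c * g = g * (g⁻¹ * x ^ i * g) * c := by
        rw [mul_assoc, (h.commute_of_mem hc g).eq]; group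
    _ = g * x ^ i * (d ^ i * c) := by rw [h1]; simp only [mul_assoc]
    _ = g * (x ^ i * c) * d ^ i := by
        rw [← (h.commute_of_mem hc (d ^ i)).eq]; simp only [mul_assoc]

/-- The factors `e ^ n` and `c ^ (n choose 2)` of the product formula vanish. -/
theorem mul_pow_eq (h : IsNormalRankTwo p z x) {e : G} (he : e ∈ zpowers x ⊔ zpowers z) (g : G)
    {n : ℕ} (hn : p ∣ n) (hn2 : p ∣ n.choose 2) : (g * e) ^ n = g ^ n := by
  obtain ⟨c, hc, hcomm⟩ := h.exists_mul_comm_mul he g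
  have h1 : e ^ n = 1 := by
    obtain ⟨k, rfl⟩ := hn
    rw [pow_mul, h.pow_eq_one_of_mem_sup he, one_pow]
  have h2 : c ^ n.choose 2 = 1 := by
    obtain ⟨k, hk⟩ := hn2
    rw [hk, pow_mul, h.pow_eq_one_of_mem_zpowers hc, one_pow]
  rw [mul_pow_of_mul_comm_mul hcomm (h.commute_of_mem hc), h1, h2, mul_one, mul_one]

theorem sum_sup [Fintype G] [DecidablePred (· ∈ zpowers x ⊔ zpowers z)]
    (h : IsNormalRankTwo p z x) (hp : p.Prime) :
    ∑ g with g ∈ zpowers x ⊔ zpowers z, 1 / (orderOf g : ℚ) = (p ^ 2 + p - 1) / p := by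
  classical
  have := Fact.mk hp
  have hmem : (1 : G) ∈ Finset.univ.filter (· ∈ zpowers x ⊔ zpowers z) := by simp
  rw [← Finset.add_sum_erase _ _ hmem, Finset.sum_congr rfl (g := fun _ => 1 / (p : ℚ)),
    Finset.sum_const, Finset.card_erase_of_mem hmem,
    ← Nat.subtype_card (p := (· ∈ zpowers x ⊔ zpowers z)) _ (by simp)]
  · have hc := h.card_sup hp
    rw [show Nat.card {g // g ∈ zpowers x ⊔ zpowers z} = p ^ 2 from hc, orderOf_one, nsmul_eq_mul]
    have hp0 : (p : ℚ) ≠ 0 := by exact_mod_cast hp.ne_zero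
    push_cast [Nat.cast_sub (Nat.one_le_pow 2 p hp.pos)]
    field_simp
    ring
  · intro g hg
    simp only [Finset.mem_erase, Finset.mem_filter, Finset.mem_univ, true_and] at hg
    rw [orderOf_eq_prime (h.pow_eq_one_of_mem_sup hg.2) hg.1]

end IsNormalRankTwo

/-! ### Recognising the dihedral group of order eight -/

theorem zpow_zmod_val_eq {G : Type*} [Group G] {r : G} {n : ℕ} [NeZero n] (hr : orderOf r = n)
    (i : ZMod n) (j : ℤ) (h : (j : ZMod n) = i) : r ^ (i.val : ℤ) = r ^ j := by
  rw [zpow_eq_zpow_iff_modEq, hr]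
  exact (ZMod.intCast_eq_intCast_iff _ _ _).1 (by rw [h]; simp)

theorem nonempty_mulEquiv_dihedralGroup_four {G : Type*} [Group G] {r s : G}
    (hG : Nat.card G = 8) (hr : orderOf r = 4) (hs : s ^ 2 = 1) (hsr : s ∉ zpowers r)
    (hconj : s * r = r⁻¹ * s) : Nonempty (G ≃* DihedralGroup 4) := by
  have hcomm : ∀ i : ℤ, r ^ i * s = s * r ^ (-i) := by
    intro i
    have h1 : s * r * s⁻¹ = r⁻¹ := by rw [hconj, mul_inv_cancel_right]
    have h2 : s * r ^ (-i) * s⁻¹ = r ^ i := by rw [← conj_zpow, h1, inv_zpow, zpow_neg, inv_inv]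
    rw [← h2, inv_mul_cancel_right]
  have hss : s * s = 1 := by rw [← sq, hs]
  let f : DihedralGroup 4 →* G :=
    { toFun := fun a => match a with
        | .r i => r ^ (i.val : ℤ)
        | .sr i => s * r ^ (i.val : ℤ)
      map_one' := by
        change r ^ ((0 : ZMod 4).val : ℤ) = 1
        simp
      map_mul' := by
        rintro (i | i) (j | j)
        · rw [DihedralGroup.r_mul_r]
          change r ^ ((i + j).val : ℤ) = r ^ (i.val : ℤ) * r ^ (j.val : ℤ)
          rw [← zpow_add]
          exact zpow_zmod_val_eq hr _ _ (by simp)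
        · rw [DihedralGroup.r_mul_sr]
          change s * r ^ ((j - i).val : ℤ) = r ^ (i.val : ℤ) * (s * r ^ (j.val : ℤ))
          rw [← mul_assoc, hcomm, mul_assoc, ← zpow_add,
            zpow_zmod_val_eq hr (j - i) (-(i.val : ℤ) + j.val) (by simp; ring)]
        · rw [DihedralGroup.sr_mul_r]
          change s * r ^ ((i + j).val : ℤ) = s * r ^ (i.val : ℤ) * r ^ (j.val : ℤ)
          rw [mul_assoc, ← zpow_add, zpow_zmod_val_eq hr (i + j) ((i.val : ℤ) + j.val) (by simp)]
        · rw [DihedralGroup.sr_mul_sr]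
          change r ^ ((j - i).val : ℤ) = s * r ^ (i.val : ℤ) * (s * r ^ (j.val : ℤ))
          rw [mul_assoc s, ← mul_assoc _ s, hcomm, mul_assoc s, ← mul_assoc s s, hss, one_mul,
            ← zpow_add, zpow_zmod_val_eq hr (j - i) (-(i.val : ℤ) + j.val) (by simp; ring)] }
  have hf : Function.Injective f := by
    rw [injective_iff_map_eq_one]
    rintro (i | i) hi
    · change r ^ (i.val : ℤ) = 1 at hi
      rw [← orderOf_dvd_iff_zpow_eq_one, hr] at hi
      have hlt := ZMod.val_lt i
      have h0 : i.val = 0 := by omega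
      rw [(ZMod.val_eq_zero i).1 h0, DihedralGroup.r_zero]
    · change s * r ^ (i.val : ℤ) = 1 at hi
      exact absurd (eq_inv_of_mul_eq_one_left hi ▸ inv_mem (zpow_mem (mem_zpowers r) _)) hsr
  have : Finite G := Nat.finite_of_card_ne_zero (by omega)
  have hbij : Function.Bijective f := hf.bijective_of_nat_card_le
    (by rw [hG, DihedralGroup.nat_card])
  exact ⟨(MulEquiv.ofBijective f hbij).symm⟩

/-! ### Groups with a normal elementary abelian subgroup of rank two -/

theorem orderOf_eq_of_pow_eq {G : Type*} [Group G] {p : ℕ} (hp : p.Prime) (hG : IsPGroup p G)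
    {g h : G} {j : ℕ} (hg : g ^ p ^ j ≠ 1) (hh : h ^ p ^ j ≠ 1)
    (hgh : ∀ k, j < k → g ^ p ^ k = h ^ p ^ k) : orderOf g = orderOf h := by
  have := Fact.mk hp
  have key : ∀ {g h : G}, g ^ p ^ j ≠ 1 → (∀ k, j < k → g ^ p ^ k = h ^ p ^ k) →
      orderOf h ∣ orderOf g := by
    intro g h hg hgh
    obtain ⟨a, ha⟩ := IsPGroup.iff_orderOf.1 hG g
    have hja : j < a := by
      by_contra! hle
      exact hg (orderOf_dvd_iff_pow_eq_one.1 (ha ▸ pow_dvd_pow p hle))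
    rw [ha]
    exact orderOf_dvd_of_pow_eq_one (by rw [← hgh a hja, ← ha, pow_orderOf_eq_one])
  exact Nat.dvd_antisymm (key hh fun k hk => (hgh k hk).symm) (key hg hgh)

theorem two_mul_choose_two (n : ℕ) : 2 * n.choose 2 = n * (n - 1) := by
  rw [Nat.choose_two_right, Nat.mul_div_cancel' (Nat.even_mul_pred_self n).two_dvd]

theorem pow_mem_iff_of_zpowers_mk_eq {G : Type*} [Group G] {E : Subgroup G} [E.Normal] {g h : G}
    (hgh : zpowers (g : G ⧸ E) = zpowers (h : G ⧸ E)) (n : ℕ) : g ^ n ∈ E ↔ h ^ n ∈ E := by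
  rw [← QuotientGroup.eq_one_iff, ← QuotientGroup.eq_one_iff, QuotientGroup.mk_pow,
    QuotientGroup.mk_pow, ← orderOf_dvd_iff_pow_eq_one, ← orderOf_dvd_iff_pow_eq_one,
    orderOf_eq_of_zpowers_eq hgh]

/-- For odd `p` the order is constant on every coset of the rank two subgroup `E` other than `E`
itself, so the elements outside `E` contribute an integer to the sum of inverse orders, and those
of `E` contribute `(p ^ 2 + p - 1) / p`. -/
theorem IsNormalRankTwo.harmonicMeanOrders_ne_natCast_of_odd {G : Type*} [Group G] [Fintype G]
    {p : ℕ} (hp : p.Prime) (hp2 : p ≠ 2) (hG : IsPGroup p G) {z x : G}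
    (h : IsNormalRankTwo p z x) (k : ℕ) : harmonicMeanOrders G ≠ k := by
  classical
  have := Fact.mk hp
  have := h.normal_sup
  obtain ⟨N, hN⟩ := exists_int_sum_inv_orderOf hp hG (zpowers x ⊔ zpowers z) (h.card_sup hp)
    (fun e he => h.pow_eq_one_of_mem_sup he)
    (Finset.univ.filter (· ∉ zpowers x ⊔ zpowers z)) (by simp)
    (by
      intro g hg g' hgg'
      simp only [Finset.mem_filter, Finset.mem_univ, true_and] at hg ⊢
      simpa using (pow_mem_iff_of_zpowers_mk_eq hgg' 1).not.1 (by simpa using hg))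
    (by
      intro g hg e he
      simp only [Finset.mem_filter, Finset.mem_univ, true_and] at hg
      refine orderOf_eq_of_pow_eq hp hG (j := 0) ?_ ?_ fun k hk => ?_
      · rw [pow_zero, pow_one]
        exact fun h1 => hg ((mul_mem_cancel_right he).1 (h1 ▸ one_mem _))
      · rw [pow_zero, pow_one]
        exact fun h1 => hg (h1 ▸ one_mem _)
      · have hdvd : p ∣ p ^ k := dvd_pow_self p hk.ne'
        refine h.mul_pow_eq he g hdvd ?_
        exact ((Nat.coprime_primes hp Nat.prime_two).2 hp2).dvd_of_dvd_mul_left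
          (two_mul_choose_two _ ▸ hdvd.mul_right _))
  have hp0 : (p : ℚ) ≠ 0 := by exact_mod_cast hp.ne_zero
  refine harmonicMeanOrders_ne_natCast_of_sum_eq hp hG (q := p ^ 2 + p - 1 + p * N) ?_ ?_ k
  · rw [sumInvOrders, ← Finset.sum_filter_add_sum_filter_not _ (· ∈ zpowers x ⊔ zpowers z),
      h.sum_sup hp, hN]
    push_cast
    field_simp
  · intro hdvd
    have h1 : (p : ℤ) ∣ 1 := by
      have h2 : (1 : ℤ) = p * (p + 1 + N) - (p ^ 2 + p - 1 + p * N) := by ring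
      rw [h2]
      exact dvd_sub (dvd_mul_right _ _) hdvd
    exact (Nat.prime_iff_prime_int.1 hp).not_isUnit (isUnit_of_dvd_one h1)

theorem IsPGroup.exists_mem_center_of_normal {G : Type*} [Group G] [Finite G] {p : ℕ}
    (hp : p.Prime) (hG : IsPGroup p G) {N : Subgroup G} [N.Normal] (hN : N ≠ ⊥) :
    ∃ d ∈ N, d ≠ 1 ∧ d ^ p = 1 ∧ ∀ g, Commute d g := by
  have := Fact.mk hp
  have hdvd : p ∣ Nat.card N := by
    rcases (hG.to_subgroup N).card_eq_or_dvd with h | h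
    · exact absurd (card_eq_one.1 h) hN
    · exact h
  have hG' : IsPGroup p (ConjAct G) := hG.of_equiv ConjAct.toConjAct
  obtain ⟨b, hb, hb1⟩ := hG'.exists_fixed_point_of_prime_dvd_card_of_fixed_point N hdvd (a := 1)
    (by simp [MulAction.mem_fixedPoints])
  have hcomm : ∀ g, Commute (b : G) g := by
    intro g
    have h1 := congrArg Subtype.val (hb (ConjAct.toConjAct g))
    rw [ConjAct.Subgroup.val_conj_smul, ConjAct.toConjAct_smul] at h1
    exact (mul_inv_eq_iff_eq_mul.1 h1).symm
  obtain ⟨m, hm⟩ := IsPGroup.iff_orderOf.1 hG (b : G)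
  have hm0 : m ≠ 0 := by
    rintro rfl
    rw [pow_zero, orderOf_eq_one_iff] at hm
    exact hb1 (Subtype.ext hm.symm)
  obtain ⟨k, rfl⟩ := Nat.exists_eq_succ_of_ne_zero hm0
  refine ⟨b ^ p ^ k, pow_mem b.2 _, fun h => ?_, ?_, fun g => (hcomm g).pow_left _⟩
  · have h1 := orderOf_dvd_of_pow_eq_one h
    rw [hm, Nat.pow_dvd_pow_iff_le_right hp.one_lt] at h1
    omega
  · rw [← pow_mul, ← pow_succ, ← Nat.succ_eq_add_one, ← hm, pow_orderOf_eq_one]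

theorem IsPGroup.exists_central_mod {G : Type*} [Group G] [Finite G] {p : ℕ}
    (hp : p.Prime) (hG : IsPGroup p G) {N E : Subgroup G} [N.Normal] [E.Normal] (hN : ¬ N ≤ E) :
    ∃ d ∈ N, d ∉ E ∧ d ^ p ∈ E ∧ ∀ g, (g * d)⁻¹ * (d * g) ∈ E := by
  have hmap : (N.map (QuotientGroup.mk' E)).Normal :=
    ‹N.Normal›.map _ (QuotientGroup.mk'_surjective E)
  have hne : N.map (QuotientGroup.mk' E) ≠ ⊥ := by
    rwa [Ne, Subgroup.map_eq_bot_iff, QuotientGroup.ker_mk']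
  obtain ⟨_, ⟨d, hd, rfl⟩, h1, h2, h3⟩ :=
    (hG.to_quotient E).exists_mem_center_of_normal hp hne
  refine ⟨d, hd, fun h => h1 ((QuotientGroup.eq_one_iff d).2 h),
    (QuotientGroup.eq_one_iff _).1 h2, fun g => QuotientGroup.eq.1 ?_⟩
  exact (h3 g).eq.symm

theorem card_dvd_card_of_forall_mul_mem {G : Type*} [Group G] (D : Subgroup G)
    (W : Finset G) (h : ∀ w ∈ W, ∀ d ∈ D, w * d ∈ W) : Nat.card D ∣ W.card := by
  have h1 : (QuotientGroup.mk ⁻¹' ((QuotientGroup.mk : G → G ⧸ D) '' W) : Set G) = W := by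
    ext g
    constructor
    · rintro ⟨w, hw, hwg⟩
      have := h w hw _ (QuotientGroup.eq.1 hwg)
      rwa [mul_inv_cancel_left] at this
    · exact fun hg => ⟨g, hg, rfl⟩
  have h2 := QuotientGroup.card_preimage_mk D ((QuotientGroup.mk : G → G ⧸ D) '' W)
  rw [h1] at h2
  exact ⟨_, by rw [← h2]; simp⟩

namespace IsNormalRankTwo

variable {G : Type*} [Group G] {z x : G}

theorem eq_one_or_eq_of_mem_zpowers (h : IsNormalRankTwo 2 z x) {c : G} (hc : c ∈ zpowers z) :
    c = 1 ∨ c = z := by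
  classical
  have hz2 : z ^ 2 = 1 := h.orderOf_eq ▸ pow_orderOf_eq_one z
  have hf : IsOfFinOrder z := isOfFinOrder_iff_pow_eq_one.2 ⟨2, by omega, hz2⟩
  obtain ⟨i, hi, rfl⟩ := Finset.mem_image.1 ((hf.mem_zpowers_iff_mem_range_orderOf).1 hc)
  rw [h.orderOf_eq, Finset.mem_range] at hi
  interval_cases i
  · exact Or.inl (pow_zero z)
  · exact Or.inr (pow_one z)

theorem mul_self_z (h : IsNormalRankTwo 2 z x) : z * z = 1 := by
  rw [← sq]; exact h.orderOf_eq ▸ pow_orderOf_eq_one z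

theorem z_ne_one (h : IsNormalRankTwo 2 z x) : z ≠ 1 := fun hz => by
  have := h.orderOf_eq
  simp [hz] at this

/-- An element not commuting with `x` has commutator exactly `z` with `x`. -/
theorem mul_comm_mul_z (h : IsNormalRankTwo 2 z x) {g : G} (hg : ¬ Commute x g) :
    x * g = g * x * z := by
  obtain ⟨c, hc, hxg⟩ := h.conj g
  rcases h.eq_one_or_eq_of_mem_zpowers hc with rfl | rfl
  · exact absurd (by rw [mul_one] at hxg; exact hxg) hg
  · exact hxg

theorem commute_mul (h : IsNormalRankTwo 2 z x) {g g' : G} (hg : ¬ Commute x g)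
    (hg' : ¬ Commute x g') : Commute x (g * g') := by
  change x * (g * g') = g * g' * x
  calc x * (g * g') = g * (x * z) * g' := by
        rw [← mul_assoc, h.mul_comm_mul_z hg]; simp only [mul_assoc]
    _ = g * z * (x * g') := by rw [← (h.commute x).eq]; simp only [mul_assoc]
    _ = g * (z * g') * x * z := by rw [h.mul_comm_mul_z hg']; simp only [mul_assoc]
    _ = g * g' * (z * x) * z := by rw [(h.commute g').eq]; simp only [mul_assoc]
    _ = g * g' * x * (z * z) := by rw [(h.commute x).eq]; simp only [mul_assoc]
    _ = g * g' * x := by rw [h.mul_self_z, mul_one]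

theorem sq_mul (h : IsNormalRankTwo 2 z x) {g : G} (hg : ¬ Commute x g) :
    (g * x) ^ 2 = g ^ 2 * z := by
  rw [mul_pow_of_mul_comm_mul (h.mul_comm_mul_z hg) h.commute, h.pow_eq_one]
  simp

theorem commute_of_mem_sup (h : IsNormalRankTwo 2 z x) {g e : G} (hg : Commute x g)
    (he : e ∈ zpowers x ⊔ zpowers z) : Commute g e := by
  obtain ⟨i, c, hc, rfl⟩ := h.exists_of_mem_sup he
  exact (hg.symm.zpow_right i).mul_right (h.commute_of_mem hc g).symm

/-- The square of `g` commutes with `g`, so it lies in the part of `⟨x, z⟩` centralised by `g`. -/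
theorem sq_eq_one_or (h : IsNormalRankTwo 2 z x) {g : G} (hg : ¬ Commute x g)
    (hg2 : g ^ 2 ∈ zpowers x ⊔ zpowers z) : g ^ 2 = 1 ∨ g ^ 2 = z := by
  obtain ⟨i, c, hc, hi⟩ := h.exists_of_mem_sup hg2
  have hx2 : x ^ (2 : ℤ) = 1 := by exact_mod_cast h.pow_eq_one
  rcases Int.even_or_odd' i with ⟨j, rfl | rfl⟩
  · rw [zpow_mul, hx2, one_zpow, one_mul] at hi
    rw [hi]
    exact h.eq_one_or_eq_of_mem_zpowers hc
  · rw [zpow_add, zpow_mul, hx2, one_zpow, one_mul, zpow_one] at hi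
    refine absurd ?_ hg
    rw [eq_mul_inv_of_mul_eq hi.symm]
    exact ((Commute.refl g).pow_left 2).mul_left (h.commute_of_mem (inv_mem hc) g)

theorem orderOf_eq_four (h : IsNormalRankTwo 2 z x) {g : G} (hg : g ^ 2 = z) : orderOf g = 4 := by
  have := Fact.mk Nat.prime_two
  refine orderOf_eq_prime_pow (p := 2) (n := 1) (by simpa [hg] using h.z_ne_one) ?_
  rw [show 2 ^ (1 + 1) = 2 * 2 from rfl, pow_mul, hg, sq, h.mul_self_z]

theorem orderOf_eq_two {g : G} (hg : ¬ Commute x g) (hg2 : g ^ 2 = 1) : orderOf g = 2 :=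
  have := Fact.mk Nat.prime_two
  orderOf_eq_prime hg2 fun h1 => hg (h1 ▸ Commute.one_right x)

theorem not_commute_mul {g : G} (hg : ¬ Commute x g) : ¬ Commute x (g * x) := fun hc =>
  hg (by simpa using hc.mul_right (Commute.refl x).inv_right)

/-- One of `g`, `g * x` has order two and the other has order four. -/
theorem inv_orderOf_add (h : IsNormalRankTwo 2 z x) {g : G} (hg : ¬ Commute x g)
    (hg2 : g ^ 2 ∈ zpowers x ⊔ zpowers z) :
    1 / (orderOf g : ℚ) + 1 / (orderOf (g * x) : ℚ) = 3 / 4 := by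
  have h1 := h.sq_mul hg
  rcases h.sq_eq_one_or hg hg2 with h2 | h2
  · rw [h2, one_mul] at h1
    rw [orderOf_eq_two hg h2, h.orderOf_eq_four h1]
    norm_num
  · rw [h2, h.mul_self_z] at h1
    rw [orderOf_eq_two (not_commute_mul hg) h1, h.orderOf_eq_four h2]
    norm_num

theorem sum_not_commute [Fintype G] (h : IsNormalRankTwo 2 z x) (W : Finset G)
    (hW : ∀ g, g ∈ W ↔ ¬ Commute x g ∧ g ^ 2 ∈ zpowers x ⊔ zpowers z) :
    ∑ g ∈ W, 1 / (orderOf g : ℚ) = W.card * (3 / 8) := by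
  have hmul : ∀ g ∈ W, g * x ∈ W := by
    intro g hg
    obtain ⟨h1, h2⟩ := (hW g).1 hg
    refine (hW _).2 ⟨not_commute_mul h1, ?_⟩
    rw [h.sq_mul h1]
    exact mul_mem h2 (mem_sup_right (mem_zpowers z))
  have hxx : x * x = 1 := by rw [← sq, h.pow_eq_one]
  have hshift : ∑ g ∈ W, 1 / (orderOf (g * x) : ℚ) = ∑ g ∈ W, 1 / (orderOf g : ℚ) :=
    Finset.sum_bij' (fun g _ => g * x) (fun g _ => g * x) hmul hmul
      (fun g _ => by rw [mul_assoc, hxx, mul_one]) (fun g _ => by rw [mul_assoc, hxx, mul_one])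
      fun g _ => rfl
  have hsum : ∑ g ∈ W, (1 / (orderOf g : ℚ) + 1 / (orderOf (g * x) : ℚ)) = W.card * (3 / 4) := by
    rw [Finset.sum_congr rfl fun g hg => h.inv_orderOf_add ((hW g).1 hg).1 ((hW g).1 hg).2]
    simp
  rw [Finset.sum_add_distrib, hshift] at hsum
  linarith

theorem normal_centralizer (h : IsNormalRankTwo 2 z x) : (centralizer {x}).Normal := by
  refine ⟨fun n hn g => ?_⟩
  rw [mem_centralizer_singleton_iff] at hn ⊢
  obtain ⟨c, hc, hxg⟩ := h.conj g
  have hgx : g⁻¹ * x * g = x * c := by rw [mul_assoc, hxg]; group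
  have hn' : Commute n (x * c) := Commute.mul_right hn (h.commute_of_mem hc n).symm
  have key : n * (g⁻¹ * x * g) = g⁻¹ * x * g * n := by rw [hgx]; exact hn'.eq
  calc g * n * g⁻¹ * x = g * (n * (g⁻¹ * x * g)) * g⁻¹ := by group
    _ = g * (g⁻¹ * x * g * n) * g⁻¹ := by rw [key]
    _ = x * (g * n * g⁻¹) := by group

theorem sup_le_centralizer (h : IsNormalRankTwo 2 z x) :
    zpowers x ⊔ zpowers z ≤ centralizer {x} := fun _ he =>
  mem_centralizer_singleton_iff.2 (h.commute_of_mem_sup (Commute.refl x) he).symm.eq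

/-- If `⟨x, z⟩` is self-centralising and some `g` does not centralise it, then it has index two in
`G`, and one of `g`, `g * x` generates a cyclic subgroup of order four inverted by `x`. -/
theorem nonempty_mulEquiv_dihedralGroup (h : IsNormalRankTwo 2 z x)
    (hle : centralizer {x} ≤ zpowers x ⊔ zpowers z) {g : G} (hg : ¬ Commute x g)
    (hg2 : g ^ 2 ∈ zpowers x ⊔ zpowers z) : Nonempty (G ≃* DihedralGroup 4) := by
  have hmem : ∀ y, y ∈ centralizer {x} ↔ Commute x y := fun y =>
    mem_centralizer_singleton_iff.trans ⟨Eq.symm, Eq.symm⟩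
  have hidx : (centralizer {x}).index = 2 := by
    refine index_eq_two_iff.2 ⟨g, fun b => ?_⟩
    rw [hmem, hmem]
    by_cases hb : Commute x b
    · refine Or.inr ⟨hb, fun hbg => hg ?_⟩
      simpa using hb.inv_right.mul_right hbg
    · exact Or.inl ⟨h.commute_mul hb hg, hb⟩
  have hcard : Nat.card G = 8 := by
    rw [← card_mul_index (centralizer {x}), hidx, le_antisymm hle h.sup_le_centralizer,
      h.card_sup Nat.prime_two]
    norm_num
  have key : ∀ r : G, ¬ Commute x r → r ^ 2 = z → Nonempty (G ≃* DihedralGroup 4) := by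
    intro r hr hr2
    refine nonempty_mulEquiv_dihedralGroup_four hcard (h.orderOf_eq_four hr2) h.pow_eq_one ?_ ?_
    · intro hxr
      obtain ⟨i, hi⟩ := mem_zpowers_iff.1 hxr
      exact hr (hi ▸ (Commute.refl r).zpow_left i)
    · rw [h.mul_comm_mul_z hr, eq_inv_mul_iff_mul_eq, ← mul_assoc, ← mul_assoc, ← sq, hr2,
        (h.commute x).eq, mul_assoc, h.mul_self_z, mul_one]
  rcases h.sq_eq_one_or hg hg2 with h1 | h1
  · exact key (g * x) (not_commute_mul hg) (by rw [h.sq_mul hg, h1, one_mul])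
  · exact key g hg h1

/-- The set `W` is stable under multiplication by the preimage, of order eight, of a subgroup of
order two of the centre of `G ⧸ ⟨x, z⟩` consisting of cosets that commute with `x`. -/
theorem eight_dvd_card [Finite G] (h : IsNormalRankTwo 2 z x) (hG : IsPGroup 2 G)
    (hle : ¬ centralizer {x} ≤ zpowers x ⊔ zpowers z) (W : Finset G)
    (hW : ∀ g, g ∈ W ↔ ¬ Commute x g ∧ g ^ 2 ∈ zpowers x ⊔ zpowers z) : 8 ∣ W.card := by
  have := h.normal_sup
  have := h.normal_centralizer
  obtain ⟨d, hdC, hdE, hd2, hdc⟩ := hG.exists_central_mod Nat.prime_two hle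
  set E := zpowers x ⊔ zpowers z with hE
  let D := (zpowers (d : G ⧸ E)).comap (QuotientGroup.mk' E)
  have hD : Nat.card D = 8 := by
    have h1 : orderOf (d : G ⧸ E) = 2 :=
      have := Fact.mk Nat.prime_two
      orderOf_eq_prime ((QuotientGroup.eq_one_iff _).2 hd2)
        fun h1 => hdE ((QuotientGroup.eq_one_iff d).1 h1)
    have h2 := QuotientGroup.card_preimage_mk E (zpowers (d : G ⧸ E) : Set (G ⧸ E))
    have h3 : Nat.card (zpowers (d : G ⧸ E)) = 2 := by rw [Nat.card_zpowers, h1]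
    rw [h.card_sup Nat.prime_two] at h2
    exact h2.trans (congrArg (2 ^ 2 * ·) h3)
  rw [← hD]
  refine card_dvd_card_of_forall_mul_mem D W fun w hw y hy => ?_
  obtain ⟨hw1, hw2⟩ := (hW w).1 hw
  obtain ⟨i, hi⟩ := mem_zpowers_iff.1 (mem_comap.1 hy)
  have hi' : ((d ^ i : G) : G ⧸ E) = (y : G ⧸ E) := hi
  have hyC : Commute x y := by
    have h1 := mul_mem (zpow_mem hdC i) (h.sup_le_centralizer (QuotientGroup.eq.1 hi'))
    rw [mul_inv_cancel_left] at h1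
    exact (mem_centralizer_singleton_iff.1 h1).symm
  refine (hW _).2 ⟨fun hc => hw1 (by simpa using hc.mul_right hyC.inv_right), ?_⟩
  have hcomm : Commute (w : G ⧸ E) (y : G ⧸ E) := by
    rw [← hi', QuotientGroup.mk_zpow]
    have hwd : Commute (w : G ⧸ E) (d : G ⧸ E) := QuotientGroup.eq.2 (hdc w)
    exact hwd.zpow_right i
  have hd2' : (d : G ⧸ E) ^ (2 : ℤ) = 1 := by
    exact_mod_cast (QuotientGroup.eq_one_iff _).2 hd2
  rw [← QuotientGroup.eq_one_iff] at hw2 ⊢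
  rw [QuotientGroup.mk_pow] at hw2 ⊢
  rw [QuotientGroup.mk_mul, hcomm.mul_pow, hw2, one_mul, ← hi', QuotientGroup.mk_zpow,
    ← zpow_natCast, zpow_comm, Nat.cast_ofNat, hd2', one_zpow]

theorem orderOf_mul_eq (h : IsNormalRankTwo 2 z x) (hG : IsPGroup 2 G) {g e : G}
    (he : e ∈ zpowers x ⊔ zpowers z) (hgE : g ∉ zpowers x ⊔ zpowers z)
    (hg : Commute x g ∨ g ^ 2 ∉ zpowers x ⊔ zpowers z) : orderOf (g * e) = orderOf g := by
  have := h.normal_sup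
  rcases hg with hg | hg
  · refine orderOf_eq_of_pow_eq Nat.prime_two hG (j := 0) ?_ ?_ fun k hk => ?_
    · rw [pow_zero, pow_one]
      exact fun h1 => hgE ((mul_mem_cancel_right he).1 (h1 ▸ one_mem _))
    · rw [pow_zero, pow_one]
      exact fun h1 => hgE (h1 ▸ one_mem _)
    · obtain ⟨m, hm⟩ := dvd_pow_self 2 hk.ne'
      rw [(h.commute_of_mem_sup hg he).mul_pow, hm, pow_mul e, h.pow_eq_one_of_mem_sup he, one_pow,
        mul_one]
  · refine orderOf_eq_of_pow_eq Nat.prime_two hG (j := 1) ?_ ?_ fun k hk => ?_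
    · rw [pow_one]
      intro h1
      refine hg ?_
      have h2 : ((g * e : G) : G ⧸ (zpowers x ⊔ zpowers z)) = g := by
        rw [QuotientGroup.mk_mul, (QuotientGroup.eq_one_iff e).2 he, mul_one]
      rw [← QuotientGroup.eq_one_iff, QuotientGroup.mk_pow, ← h2, ← QuotientGroup.mk_pow, h1,
        QuotientGroup.mk_one]
    · rw [pow_one]
      exact fun h1 => hg (h1 ▸ one_mem _)
    · obtain ⟨m, rfl⟩ := Nat.exists_eq_add_of_le' hk
      refine h.mul_pow_eq he g (dvd_pow_self 2 (by omega)) ?_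
      have h1 := two_mul_choose_two (2 ^ (m + (1 + 1)))
      refine ⟨2 ^ m * (2 ^ (m + (1 + 1)) - 1), ?_⟩
      have h2 : 2 ^ (m + (1 + 1)) = 2 * (2 * 2 ^ m) := by ring
      rw [h2] at h1 ⊢
      have h3 : 2 * (2 * (2 ^ m * (2 * (2 * 2 ^ m) - 1))) =
          2 * (2 * 2 ^ m) * (2 * (2 * 2 ^ m) - 1) := by ring
      omega

/-- Unless `G` is dihedral of order eight, the sum of inverse orders is a half-integer: the cosets
of `⟨x, z⟩` with non-constant order contribute `3 / 8` per element, and the number of their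
elements is divisible by eight. -/
theorem nonempty_mulEquiv_of_natCast [Fintype G] (h : IsNormalRankTwo 2 z x) (hG : IsPGroup 2 G)
    {k : ℕ} (hk : harmonicMeanOrders G = k) : Nonempty (G ≃* DihedralGroup 4) := by
  classical
  have := h.normal_sup
  by_contra hD
  set E := zpowers x ⊔ zpowers z with hE
  let W : Finset G := Finset.univ.filter fun g => ¬ Commute x g ∧ g ^ 2 ∈ E
  let X : Finset G := Finset.univ.filter fun g => g ∉ E ∧ (Commute x g ∨ g ^ 2 ∉ E)
  have hW : ∀ g, g ∈ W ↔ ¬ Commute x g ∧ g ^ 2 ∈ E := fun g => by simp [W]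
  have hX : ∀ g, g ∈ X ↔ g ∉ E ∧ (Commute x g ∨ g ^ 2 ∉ E) := fun g => by simp [X]
  have h8 : 8 ∣ W.card := by
    by_cases hle : centralizer {x} ≤ E
    · have : W = ∅ := Finset.eq_empty_of_forall_notMem fun g hg =>
        hD (h.nonempty_mulEquiv_dihedralGroup hle ((hW g).1 hg).1 ((hW g).1 hg).2)
      simp [this]
    · exact h.eight_dvd_card hG hle W hW
  obtain ⟨w, hw⟩ := h8
  have hcomm : ∀ g g' : G, zpowers (g : G ⧸ E) = zpowers (g' : G ⧸ E) → Commute x g →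
      Commute x g' := by
    intro g g' hgg' hg
    obtain ⟨i, hi⟩ := mem_zpowers_iff.1 (hgg' ▸ mem_zpowers (g' : G ⧸ E))
    have hi' : ((g ^ i : G) : G ⧸ E) = (g' : G ⧸ E) := hi
    have h1 := (hg.zpow_right i).mul_right
      (h.commute_of_mem_sup (Commute.refl x) (QuotientGroup.eq.1 hi'))
    rwa [mul_inv_cancel_left] at h1
  obtain ⟨N, hN⟩ := exists_int_sum_inv_orderOf Nat.prime_two hG E (h.card_sup Nat.prime_two)
    (fun e he => h.pow_eq_one_of_mem_sup he) X (fun g hg => ((hX g).1 hg).1)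
    (by
      intro g hg g' hgg'
      rw [hX] at hg ⊢
      have h1 := (pow_mem_iff_of_zpowers_mk_eq hgg' 1).not
      rw [pow_one, pow_one] at h1
      exact ⟨h1.1 hg.1, hg.2.imp (hcomm g g' hgg')
        (pow_mem_iff_of_zpowers_mk_eq hgg' 2).not.1⟩)
    (fun g hg e he => h.orderOf_mul_eq hG he ((hX g).1 hg).1 ((hX g).1 hg).2)
  have hsplit : Finset.univ.filter (· ∉ E) = X ∪ W := by
    ext g
    rw [Finset.mem_union, hX, hW]
    have h1 : g ∈ E → Commute x g := fun hg => h.commute_of_mem_sup (Commute.refl x) hg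
    simp only [Finset.mem_filter, Finset.mem_univ, true_and]
    tauto
  have hdisj : Disjoint X W := Finset.disjoint_left.2 fun g h1 h2 => by
    rw [hX] at h1
    rw [hW] at h2
    tauto
  refine harmonicMeanOrders_ne_natCast_of_sum_eq Nat.prime_two hG (q := 5 + 2 * (N + 3 * w))
    ?_ (by omega) k hk
  rw [sumInvOrders, ← Finset.sum_filter_add_sum_filter_not _ (· ∈ E), h.sum_sup Nat.prime_two,
    hsplit, Finset.sum_union hdisj, hN, h.sum_not_commute W hW, hw]
  push_cast
  ring

end IsNormalRankTwo

/-! ### Maximal cyclic normal subgroups -/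

theorem mul_pow_of_semiconj {G : Type*} [Group G] {b x : G} {u : ℕ} (h : x * b = b ^ u * x)
    (n : ℕ) : (b * x) ^ n = b ^ (∑ i ∈ Finset.range n, u ^ i) * x ^ n := by
  have hswap : ∀ n : ℕ, x ^ n * b = b ^ u ^ n * x ^ n := by
    intro n
    induction n with
    | zero => simp
    | succ n ih =>
      have h1 : x * b ^ u ^ n = (b ^ u) ^ u ^ n * x :=
        SemiconjBy.pow_right (show SemiconjBy x b (b ^ u) from h) _
      calc x ^ (n + 1) * b = x * (x ^ n * b) := by rw [pow_succ', mul_assoc]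
        _ = (x * b ^ u ^ n) * x ^ n := by rw [ih, mul_assoc]
        _ = b ^ u ^ (n + 1) * x ^ (n + 1) := by
          rw [h1, ← pow_mul, ← pow_succ' u, mul_assoc, ← pow_succ']
  induction n with
  | zero => simp
  | succ n ih =>
    rw [pow_succ, ih, Finset.sum_range_succ, pow_add, pow_succ x]
    calc b ^ (∑ i ∈ Finset.range n, u ^ i) * x ^ n * (b * x)
        = b ^ (∑ i ∈ Finset.range n, u ^ i) * (x ^ n * b) * x := by simp only [mul_assoc]
      _ = _ := by rw [hswap]; simp only [mul_assoc]

/-- A cyclic `p`-group has only one subgroup of order `p`. -/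
theorem mem_zpowers_of_pow_eq_one {G : Type*} [Group G] {p m : ℕ} (hp : p.Prime) {a c d : G}
    (ha : orderOf a = p ^ (m + 1)) (hd : d ∈ zpowers a) (hdp : orderOf d = p)
    (hc : c ∈ zpowers a) (hcp : c ^ p = 1) : c ∈ zpowers d := by
  have key : ∀ y ∈ zpowers a, y ^ p = 1 → y ∈ zpowers (a ^ p ^ m) := by
    intro y hy hyp
    obtain ⟨i, rfl⟩ := mem_zpowers_iff.1 hy
    rw [← zpow_natCast, ← zpow_mul, ← orderOf_dvd_iff_zpow_eq_one, ha, pow_succ] at hyp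
    push_cast at hyp
    obtain ⟨j, rfl⟩ := Int.dvd_of_mul_dvd_mul_right (by exact_mod_cast hp.ne_zero) hyp
    refine mem_zpowers_iff.2 ⟨j, ?_⟩
    rw [zpow_mul, ← zpow_natCast a]
    push_cast
    rfl
  have hb : (a ^ p ^ m) ^ p = 1 := by rw [← pow_mul, ← pow_succ, ← ha, pow_orderOf_eq_one]
  have hle : orderOf (a ^ p ^ m) ≤ p := orderOf_le_of_pow_eq_one hp.pos hb
  have hf : Finite (zpowers (a ^ p ^ m)) :=
    (isOfFinOrder_iff_pow_eq_one.2 ⟨p, hp.pos, hb⟩).finite_zpowers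
  have heq : zpowers d = zpowers (a ^ p ^ m) := eq_of_le_of_card_ge
    (zpowers_le.2 (key d hd (hdp ▸ pow_orderOf_eq_one d)))
    (by rw [Nat.card_zpowers, Nat.card_zpowers, hdp]; exact hle)
  rw [heq]
  exact key c hc hcp

/-- Let `⟨a⟩` be a maximal cyclic normal subgroup and let `x ∉ ⟨a⟩` be central of order `p` modulo
`⟨a⟩`. On `⟨a⟩` the norm of the action of `x` is `p` times a unit, so `x` may be multiplied by an
element of `⟨a⟩` to get an element of order `p`; otherwise `x ^ p` would generate `⟨a⟩` and `⟨x⟩`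
would be a larger cyclic normal subgroup. -/
theorem exists_isNormalRankTwo {G : Type*} [Group G] [Finite G] {p : ℕ} (hp : p.Prime)
    (hG : IsPGroup p G) {a x : G} (hA : (zpowers a).Normal) (ha : a ≠ 1)
    (hmax : ∀ b, (zpowers b).Normal → zpowers a ≤ zpowers b → zpowers b ≤ zpowers a)
    (hx : x ∉ zpowers a) (hxp : x ^ p ∈ zpowers a)
    (hcen : ∀ g, (g * x)⁻¹ * (x * g) ∈ zpowers a) {u k : ℕ} (hu : x * a = a ^ u * x)
    (hk : ∑ i ∈ Finset.range p, u ^ i = p * k) (hpk : ¬ p ∣ k) :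
    ∃ z y : G, IsNormalRankTwo p z y := by
  have := Fact.mk hp
  have hcop : Nat.Coprime p k := (hp.coprime_iff_not_dvd).2 hpk
  obtain ⟨m, hm⟩ := IsPGroup.iff_orderOf.1 hG a
  have hm0 : m ≠ 0 := by
    rintro rfl
    exact ha (orderOf_eq_one_iff.1 (by simpa using hm))
  obtain ⟨m, rfl⟩ := Nat.exists_eq_succ_of_ne_zero hm0
  obtain ⟨z, hzA, hz1, hzp, hzc⟩ := hG.exists_mem_center_of_normal hp (N := zpowers a)
    (by rwa [Ne, zpowers_eq_bot])
  have hzo : orderOf z = p := orderOf_eq_prime hzp hz1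
  have hgen : ∀ i : ℕ, Nat.Coprime p i → a ∈ zpowers (a ^ i) := fun i hi => by
    rw [mem_zpowers_pow_iff, hm]
    exact (Nat.Coprime.pow_left _ hi).symm
  have hnorm : ∀ b ∈ zpowers a, (b * x) ^ p = b ^ (p * k) * x ^ p := by
    intro b hb
    obtain ⟨j, rfl⟩ := mem_zpowers_iff.1 hb
    rw [← hk]
    refine mul_pow_of_semiconj ?_ p
    have h1 : x * a ^ j = (a ^ u) ^ j * x :=
      SemiconjBy.zpow_right (show SemiconjBy x a (a ^ u) from hu) j
    rw [h1, ← zpow_natCast, ← zpow_natCast, zpow_comm]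
  obtain ⟨i, hi⟩ := mem_powers_iff_mem_zpowers.2 hxp
  change a ^ i = x ^ p at hi
  have hpi : p ∣ i := by
    by_contra hpi
    have hle : zpowers a ≤ zpowers x := by
      rw [zpowers_le]
      have h1 := hgen i ((hp.coprime_iff_not_dvd).2 hpi)
      rw [hi] at h1
      exact (zpowers_le.2 (pow_mem (mem_zpowers x) p)) h1
    refine hx (hmax x ⟨fun n hn g => ?_⟩ hle (mem_zpowers x))
    obtain ⟨j, rfl⟩ := mem_zpowers_iff.1 hn
    rw [← conj_zpow]
    refine zpow_mem ?_ j
    have h1 := mul_mem (mem_zpowers x) (hle (hcen g⁻¹))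
    have h2 : x * ((g⁻¹ * x)⁻¹ * (x * g⁻¹)) = g * x * g⁻¹ := by group
    rwa [h2] at h1
  obtain ⟨j, rfl⟩ := hpi
  obtain ⟨b, hb, hbk⟩ : ∃ b ∈ zpowers a, b ^ k = (a ^ j)⁻¹ := by
    obtain ⟨t, ht⟩ := mem_zpowers_iff.1
      (inv_mem (pow_mem (hgen k hcop) j) : (a ^ j)⁻¹ ∈ zpowers (a ^ k))
    refine ⟨a ^ t, zpow_mem (mem_zpowers a) t, ?_⟩
    rw [← ht, ← zpow_natCast, zpow_comm, zpow_natCast]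
  have hy : (b * x) ^ p = 1 := by
    rw [hnorm b hb, ← hi, mul_comm p k, pow_mul, hbk, mul_comm p j, pow_mul, inv_pow,
      inv_mul_cancel]
  have hyA : b * x ∉ zpowers a := fun h => hx ((mul_mem_cancel_left hb).1 h)
  refine ⟨z, b * x, hzo, hzc, fun h => hyA ((zpowers_le.2 hzA) h), hy, fun g => ?_⟩
  -- The conjugate of `b * x` is `c * (b * x)` with `c ∈ ⟨a⟩`, and comparing `p`-th powers shows
  -- that `c ^ p = 1`.
  set c := g⁻¹ * (b * x) * g * (b * x)⁻¹ with hcdef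
  have hb1 : (b : G ⧸ zpowers a) = 1 := (QuotientGroup.eq_one_iff b).2 hb
  have hcA : c ∈ zpowers a := by
    have hxg : ((g * x : G) : G ⧸ zpowers a) = (x * g : G) := QuotientGroup.eq.2 (hcen g)
    rw [QuotientGroup.mk_mul, QuotientGroup.mk_mul] at hxg
    rw [← QuotientGroup.eq_one_iff, hcdef]
    simp only [QuotientGroup.mk_mul, QuotientGroup.mk_inv, hb1, one_mul]
    rw [mul_assoc _⁻¹, ← hxg, inv_mul_cancel_left, mul_inv_cancel]
  have hcy : c * (b * x) = g⁻¹ * (b * x) * g := by rw [hcdef]; group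
  have hcomm : Commute c b := by
    obtain ⟨s, hs⟩ := mem_zpowers_iff.1 hcA
    obtain ⟨t, ht⟩ := mem_zpowers_iff.1 hb
    rw [← hs, ← ht]
    exact ((Commute.refl a).zpow_left s).zpow_right t
  have hcpk : (c ^ p) ^ k = 1 := by
    have h1 : (c * (b * x)) ^ p = 1 := by
      have h2 := conj_pow (i := p) (a := g⁻¹) (b := b * x)
      rw [inv_inv] at h2
      rw [hcy, h2, hy]
      group
    rw [← mul_assoc, hnorm _ (mul_mem hcA hb), hcomm.mul_pow, mul_assoc, ← hnorm b hb, hy,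
      mul_one, pow_mul] at h1
    exact h1
  have hcp : c ^ p = 1 := by
    have h1 := orderOf_dvd_of_pow_eq_one hcpk
    exact orderOf_eq_one_iff.1 (Nat.eq_one_of_dvd_coprimes (hG.orderOf_coprime hcop (c ^ p))
      dvd_rfl h1)
  have hcz : c ∈ zpowers z := mem_zpowers_of_pow_eq_one hp hm hzA hzo hcA hcp
  refine ⟨c, hcz, ?_⟩
  obtain ⟨s, hs⟩ := mem_zpowers_iff.1 hcz
  have hcc : Commute c (b * x) := hs ▸ (hzc _).zpow_left s
  calc b * x * g = g * (g⁻¹ * (b * x) * g) := by group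
    _ = g * (b * x) * c := by rw [← hcy, hcc.eq, ← mul_assoc g]

theorem exists_maximal_zpowers_normal {G : Type*} [Group G] [Finite G] [Nontrivial G] {p : ℕ}
    (hp : p.Prime) (hG : IsPGroup p G) : ∃ a : G, a ≠ 1 ∧ (zpowers a).Normal ∧
      ∀ b, (zpowers b).Normal → zpowers a ≤ zpowers b → zpowers b ≤ zpowers a := by
  obtain ⟨d, -, hd1, -, hd⟩ := hG.exists_mem_center_of_normal hp (N := ⊤) top_ne_bot
  have hdn : (zpowers d).Normal := ⟨fun n hn g => by
    obtain ⟨j, rfl⟩ := mem_zpowers_iff.1 hn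
    rwa [← ((hd g).zpow_left j).eq, mul_inv_cancel_right]⟩
  obtain ⟨a, han, ha⟩ := Set.exists_max_image {a : G | (zpowers a).Normal} orderOf
    (Set.toFinite _) ⟨d, hdn⟩
  refine ⟨a, fun h => ?_, han, fun b hb hle => ?_⟩
  · have h1 := ha d hdn
    rw [h, orderOf_one] at h1
    have h2 := orderOf_pos d
    exact hd1 (orderOf_eq_one_iff.1 (by omega))
  · exact (eq_of_le_of_card_ge hle (by rw [Nat.card_zpowers, Nat.card_zpowers]; exact ha b hb)).ge

theorem exists_mul_eq_pow_mul {G : Type*} [Group G] [Finite G] {a : G} (hA : (zpowers a).Normal)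
    (x : G) : ∃ u : ℕ, x * a = a ^ u * x := by
  obtain ⟨u, hu⟩ := mem_powers_iff_mem_zpowers.2 (hA.conj_mem a (mem_zpowers a) x)
  exact ⟨u, by rw [show a ^ u = x * a * x⁻¹ from hu, inv_mul_cancel_right]⟩

theorem exists_sum_pow_eq {p u : ℕ} (hp : p.Prime) (hp2 : p ≠ 2) (hu : u ^ p ≡ 1 [MOD p]) :
    ∃ k, ∑ i ∈ Finset.range p, u ^ i = p * k ∧ ¬ p ∣ k := by
  have := Fact.mk hp
  have hu1 : u % p = 1 := by
    have h1 : (u : ZMod p) = (1 : ℕ) := by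
      have h2 := (ZMod.natCast_eq_natCast_iff _ _ _).2 hu
      rwa [Nat.cast_pow, ZMod.pow_card] at h2
    have h3 := (ZMod.natCast_eq_natCast_iff' _ _ _).1 h1
    rwa [Nat.mod_eq_of_lt hp.one_lt] at h3
  obtain ⟨t, rfl⟩ : ∃ t, u = p * t + 1 := ⟨u / p, by rw [← hu1, Nat.div_add_mod]⟩
  have hpow : ∀ i, ∃ w, (p * t + 1) ^ i = 1 + p * t * i + p ^ 2 * w := by
    intro i
    induction i with
    | zero => exact ⟨0, by simp⟩
    | succ i ih =>
      obtain ⟨w, hw⟩ := ih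
      exact ⟨t * t * i + w * (p * t + 1), by rw [pow_succ, hw]; ring⟩
  choose w hw using hpow
  obtain ⟨c, hc⟩ : p ∣ ∑ i ∈ Finset.range p, i := by
    have h1 := Finset.sum_range_id_mul_two p
    exact ((Nat.coprime_primes hp Nat.prime_two).2 hp2).dvd_of_dvd_mul_right
      (h1 ▸ dvd_mul_right _ _)
  refine ⟨1 + p * (t * c + ∑ i ∈ Finset.range p, w i), ?_, ?_⟩
  · rw [Finset.sum_congr rfl fun i _ => hw i, Finset.sum_add_distrib, Finset.sum_add_distrib,
      ← Finset.mul_sum, ← Finset.mul_sum, hc]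
    simp
    ring
  · rw [Nat.dvd_add_left (dvd_mul_right _ _)]
    exact hp.not_dvd_one

theorem modEq_one_of_pow_mem {G : Type*} [Group G] {a x : G} {u n : ℕ} (hu : x * a = a ^ u * x)
    (hx : x ^ n ∈ zpowers a) : u ^ n ≡ 1 [MOD orderOf a] := by
  have hswap : ∀ n : ℕ, x ^ n * a = a ^ u ^ n * x ^ n := by
    intro n
    induction n with
    | zero => simp
    | succ n ih =>
      have h1 : x * a ^ u ^ n = (a ^ u) ^ u ^ n * x :=
        SemiconjBy.pow_right (show SemiconjBy x a (a ^ u) from hu) _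
      rw [pow_succ', mul_assoc, ih, ← mul_assoc, h1, ← pow_mul, ← pow_succ' u, mul_assoc]
  obtain ⟨j, hj⟩ := mem_zpowers_iff.1 hx
  have h1 : Commute (x ^ n) a := hj ▸ (Commute.refl a).zpow_left j
  have h2 : a ^ u ^ n = a ^ 1 := by
    rw [pow_one]
    exact mul_right_cancel ((hswap n).symm.trans h1.eq)
  exact pow_eq_pow_iff_modEq.1 h2

theorem isCyclic_or_exists_isNormalRankTwo {G : Type*} [Group G] [Finite G] [Nontrivial G] {p : ℕ}
    (hp : p.Prime) (hp2 : p ≠ 2) (hG : IsPGroup p G) :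
    IsCyclic G ∨ ∃ z x : G, IsNormalRankTwo p z x := by
  have := Fact.mk hp
  obtain ⟨a, ha1, hA, hmax⟩ := exists_maximal_zpowers_normal hp hG
  by_cases htop : ⊤ ≤ zpowers a
  · exact Or.inl ⟨a, fun g => htop (mem_top g)⟩
  obtain ⟨x, -, hx, hxp, hcen⟩ := hG.exists_central_mod hp (N := ⊤) htop
  obtain ⟨u, hu⟩ := exists_mul_eq_pow_mul hA x
  obtain ⟨k, hk, hpk⟩ := exists_sum_pow_eq hp hp2
    ((modEq_one_of_pow_mem hu hxp).of_dvd (hG.dvd_orderOf ha1))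
  exact Or.inr (exists_isNormalRankTwo hp hG hA ha1 hmax hx hxp hcen hu hk hpk)

/-- A `2`-group without a normal four-group is cyclic or has a cyclic subgroup of index two on
which the other elements act by an exponent congruent to `3` modulo `4`. Indeed, let `⟨a⟩` be a
maximal cyclic normal subgroup and `C` the centraliser of its elements of order four, of index at
most two. An element outside `⟨a⟩` of `C` acts by an exponent congruent to `1` modulo `4`, so its
norm is twice an odd number. -/
theorem isCyclic_or_exists_isNormalRankTwo_or {G : Type*} [Group G] [Finite G] [Nontrivial G]
    (hG : IsPGroup 2 G) :
    IsCyclic G ∨ (∃ z x : G, IsNormalRankTwo 2 z x) ∨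
      ∃ (a x : G) (m u : ℕ), orderOf a = 2 ^ (m + 2) ∧ (zpowers a).index = 2 ∧ x ∉ zpowers a ∧
        x * a = a ^ u * x ∧ u % 4 = 3 := by
  have := Fact.mk Nat.prime_two
  obtain ⟨a, ha1, hA, hmax⟩ := exists_maximal_zpowers_normal Nat.prime_two hG
  by_cases htop : ⊤ ≤ zpowers a
  · exact Or.inl ⟨a, fun g => htop (mem_top g)⟩
  right
  obtain ⟨n, hn⟩ := IsPGroup.iff_orderOf.1 hG a
  by_cases hn2 : n < 2
  · -- Here `⟨a⟩` has order two, so every element acts on it trivially.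
    obtain ⟨x, -, hx, hxp, hcen⟩ := hG.exists_central_mod Nat.prime_two (N := ⊤) htop
    have ha2 : a ^ 2 = 1 := orderOf_dvd_iff_pow_eq_one.1
      (hn ▸ pow_dvd_pow 2 (show n ≤ 1 by omega))
    obtain ⟨u, hu⟩ := exists_mul_eq_pow_mul hA x
    have hu1 : x * a = a ^ 1 * x := by
      rcases Nat.even_or_odd' u with ⟨v, rfl | rfl⟩
      · rw [pow_mul, ha2, one_pow, one_mul] at hu
        exact absurd (mul_eq_left.1 hu) ha1
      · rwa [pow_add, pow_mul, ha2, one_pow, one_mul] at hu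
    exact Or.inl (exists_isNormalRankTwo Nat.prime_two hG hA ha1 hmax hx hxp hcen hu1 (k := 1)
      (by simp) (by norm_num))
  obtain ⟨m, rfl⟩ := Nat.exists_eq_add_of_le' (not_lt.1 hn2)
  set t := a ^ 2 ^ m with ht
  have hto : orderOf t = 4 := by
    rw [ht, orderOf_pow_of_dvd (by positivity) (by rw [hn]; exact pow_dvd_pow 2 (by omega)), hn,
      pow_add]
    exact Nat.mul_div_cancel_left _ (by positivity)
  have hact : ∀ g (u : ℕ), g * a = a ^ u * g → g * t = t ^ u * g := by
    intro g u hu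
    have h1 : g * a ^ 2 ^ m = (a ^ u) ^ 2 ^ m * g :=
      SemiconjBy.pow_right (show SemiconjBy g a (a ^ u) from hu) _
    rw [ht, h1, ← pow_mul, ← pow_mul, mul_comm]
  have htn : (zpowers t).Normal := by
    refine ⟨fun y hy g => ?_⟩
    obtain ⟨j, rfl⟩ := mem_zpowers_iff.1 hy
    obtain ⟨u, hu⟩ := exists_mul_eq_pow_mul hA g
    rw [← conj_zpow, hact g u hu, mul_inv_cancel_right]
    exact zpow_mem (pow_mem (mem_zpowers t) u) j
  have hmemC : ∀ g, g ∈ centralizer (zpowers t : Set G) ↔ Commute g t := by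
    intro g
    rw [mem_centralizer_iff]
    constructor
    · exact fun h => (h t (mem_zpowers t)).symm
    · rintro h _ ⟨j, rfl⟩
      exact (h.zpow_right j).eq.symm
  have hmod : ∀ g (u : ℕ), g * a = a ^ u * g → Commute g t → u % 4 = 1 := by
    intro g u hu hg
    have h1 : t ^ u = t ^ 1 := by
      rw [pow_one]
      exact mul_right_cancel ((hact g u hu).symm.trans hg.eq)
    have h2 := pow_eq_pow_iff_modEq.1 h1
    rwa [hto] at h2
  by_cases hle : centralizer (zpowers t : Set G) ≤ zpowers a
  · right
    have ht4 : t ^ 4 = 1 := hto ▸ pow_orderOf_eq_one t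
    have haC : ∀ g ∈ zpowers a, Commute g t := by
      intro g hg
      obtain ⟨j, rfl⟩ := mem_zpowers_iff.1 hg
      exact ((Commute.refl a).zpow_left j).pow_right _
    have hodd : ∀ g, g ∉ zpowers a → ∀ u : ℕ, g * a = a ^ u * g → u % 4 = 3 := by
      intro g hg u hu
      have h1 := hact g u hu
      have hdm : t ^ u = t ^ (u % 4) := by rw [← hto, pow_mod_orderOf]
      have hlt : u % 4 < 4 := Nat.mod_lt _ (by norm_num)
      have hne1 : u % 4 ≠ 1 := fun h => hg (hle ((hmemC g).2
        (by rw [hdm, h, pow_one] at h1; exact h1)))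
      have hconj : g * t * g⁻¹ = t ^ u := by rw [h1, mul_inv_cancel_right]
      -- An even exponent would give a conjugate of `t` of order at most two.
      have hne0 : u % 2 ≠ 0 := by
        intro h
        obtain ⟨v, rfl⟩ := Nat.dvd_of_mod_eq_zero h
        have h2 : (g * t * g⁻¹) ^ 2 = 1 := by
          rw [hconj, ← pow_mul, show 2 * v * 2 = 4 * v by ring, pow_mul, ht4, one_pow]
        rw [conj_pow, mul_inv_eq_one, mul_eq_left] at h2
        have h3 := orderOf_dvd_of_pow_eq_one h2
        rw [hto] at h3
        omega
      omega
    obtain ⟨x, -, hx⟩ := Set.not_subset.1 htop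
    have hx : x ∉ zpowers a := hx
    have hinv : ∀ g, g ∉ zpowers a → g * t = t⁻¹ * g := by
      intro g hg
      obtain ⟨u, hu⟩ := exists_mul_eq_pow_mul hA g
      have h1 : t ^ u = t⁻¹ := by
        rw [← pow_mod_orderOf, hto, hodd g hg u hu, eq_inv_iff_mul_eq_one, ← pow_succ]
        exact ht4
      rw [hact g u hu, h1]
    have hidx : (zpowers a).index = 2 := by
      refine index_eq_two_iff.2 ⟨x, fun b => ?_⟩
      by_cases hb : b ∈ zpowers a
      · exact Or.inr ⟨hb, fun h => hx ((mul_mem_cancel_left hb).1 h)⟩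
      · refine Or.inl ⟨hle ((hmemC _).2 ?_), hb⟩
        have h1 : b * t⁻¹ = t * b := by
          rw [mul_inv_eq_iff_eq_mul, mul_assoc, hinv b hb, mul_inv_cancel_left]
        change b * x * t = t * (b * x)
        rw [mul_assoc, hinv x hx, ← mul_assoc, h1, mul_assoc]
    obtain ⟨u, hu⟩ := exists_mul_eq_pow_mul hA x
    exact ⟨a, x, m, u, hn, hidx, hx, hu, hodd x hx u hu⟩
  · left
    obtain ⟨x, hxC, hx, hxp, hcen⟩ := hG.exists_central_mod Nat.prime_two hle
    obtain ⟨u, hu⟩ := exists_mul_eq_pow_mul hA x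
    have hu4 := hmod x u hu ((hmemC x).1 hxC)
    refine exists_isNormalRankTwo Nat.prime_two hG hA ha1 hmax hx hxp hcen hu
      (k := (1 + u) / 2) ?_ (by omega)
    rw [Finset.sum_range_succ, Finset.sum_range_one, pow_zero, pow_one]
    omega

/-! ### Two-groups with a cyclic subgroup of index two -/

theorem ne_two_pow_of_lt_of_lt {N k : ℕ} (h1 : 2 ^ k < N) (h2 : N < 2 ^ (k + 1)) (r : ℕ) :
    N ≠ 2 ^ r := by
  rintro rfl
  have h3 := (Nat.pow_lt_pow_iff_right (by norm_num)).1 h1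
  have h4 := (Nat.pow_lt_pow_iff_right (by norm_num)).1 h2
  omega

theorem add_add_two_pow_ne_of_four (m r : ℕ) (hm : m ≠ 0) : 4 + m + 4 * 2 ^ m ≠ 2 ^ r := by
  have h := Nat.lt_two_pow_self (n := m)
  have h1 : 2 ≤ 2 ^ m := by omega
  refine ne_two_pow_of_lt_of_lt (k := m + 2) ?_ ?_ r <;> simp only [pow_succ] <;> omega

theorem add_add_two_pow_ne_of_two (m r : ℕ) : 4 + m + 2 * 2 ^ m ≠ 2 ^ r := by
  match m with
  | 0 => exact ne_two_pow_of_lt_of_lt (k := 2) (by norm_num) (by norm_num) r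
  | 1 => exact ne_two_pow_of_lt_of_lt (k := 3) (by norm_num) (by norm_num) r
  | m + 2 =>
    have h := Nat.lt_two_pow_self (n := m)
    refine ne_two_pow_of_lt_of_lt (k := m + 3) ?_ ?_ r <;> simp only [pow_succ] <;> omega

theorem add_add_two_pow_ne_of_three (m r : ℕ) (hm : m ≠ 0) : 4 + m + 3 * 2 ^ m ≠ 2 ^ r := by
  match m with
  | 1 => exact ne_two_pow_of_lt_of_lt (k := 3) (by norm_num) (by norm_num) r
  | 2 => exact ne_two_pow_of_lt_of_lt (k := 4) (by norm_num) (by norm_num) r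
  | m + 3 =>
    have h := Nat.lt_two_pow_self (n := m)
    refine ne_two_pow_of_lt_of_lt (k := m + 4) ?_ ?_ r <;> simp only [pow_succ] <;> omega

/-- If the elements outside a cyclic subgroup of index two and order `2 ^ (m + 2)` contribute
`c * 2 ^ m / 2` to the sum of inverse orders, then an integral harmonic mean makes
`4 + m + c * 2 ^ m` a power of two. -/
theorem exists_eq_two_pow {G : Type*} [Group G] [Fintype G] {a : G} {m c k : ℕ}
    [DecidablePred (· ∈ zpowers a)] (ha : orderOf a = 2 ^ (m + 2))
    (hidx : (zpowers a).index = 2)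
    (hsum : ∑ g with g ∉ zpowers a, 1 / (orderOf g : ℚ) = c * 2 ^ m / 2)
    (hk : harmonicMeanOrders G = k) : ∃ r, 4 + m + c * 2 ^ m = 2 ^ r := by
  have hcard : Nat.card G = 2 ^ (m + 3) := by
    rw [← card_mul_index (zpowers a), hidx, Nat.card_zpowers, ha, ← pow_succ]
  have hS : sumInvOrders G = (4 + m + c * 2 ^ m : ℕ) / 2 := by
    rw [sumInvOrders, ← Finset.sum_filter_add_sum_filter_not _ (· ∈ zpowers a), hsum,
      sum_mem_inv_orderOf,
      sumInvOrders_of_isCyclic Nat.prime_two ((Nat.card_zpowers a).trans ha)]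
    push_cast
    ring
  have hpos := one_le_sumInvOrders G
  rw [harmonicMeanOrders, div_eq_iff (by linarith), hS, Fintype.card_eq_nat_card, hcard] at hk
  have hk' : 2 ^ (m + 4) = k * (4 + m + c * 2 ^ m) := by
    have : (2 : ℚ) ^ (m + 4) = k * (4 + m + c * 2 ^ m : ℕ) := by
      rw [pow_succ]
      push_cast at hk ⊢
      rw [hk]
      ring
    exact_mod_cast this
  obtain ⟨r, -, hr⟩ := (Nat.dvd_prime_pow Nat.prime_two).1 ⟨k, hk'.trans (mul_comm _ _)⟩
  exact ⟨r, hr⟩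

/-- Outside `⟨a⟩` all squares lie in the subgroup `⟨z⟩` of order two, and passing from `g` to
`a * g` multiplies the square by a fixed element of `⟨z⟩`. So either all orders there agree, or
half of the elements have order two and the other half have order four. -/
theorem nonempty_mulEquiv_dihedralGroup_of_index_two {G : Type*} [Group G] [Fintype G] {a x : G}
    {m u k : ℕ} (ha : orderOf a = 2 ^ (m + 2)) (hidx : (zpowers a).index = 2)
    (hx : x ∉ zpowers a) (hu : x * a = a ^ u * x) (hu4 : u % 4 = 3)
    (hk : harmonicMeanOrders G = k) : Nonempty (G ≃* DihedralGroup 4) := by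
  classical
  have := Fact.mk Nat.prime_two
  set z := a ^ 2 ^ (m + 1) with hz
  have hz2 : z ^ 2 = 1 := by
    rw [hz, ← pow_mul, ← pow_succ, ← ha, pow_orderOf_eq_one]
  have hz1 : z ≠ 1 := by
    intro h
    have h1 := orderOf_dvd_of_pow_eq_one h
    rw [ha, Nat.pow_dvd_pow_iff_le_right (by norm_num)] at h1
    omega
  have hout : ∀ g, g ∉ zpowers a → ∃ j : ℕ, g = a ^ j * x := by
    intro g hg
    have h1 : g * x⁻¹ ∈ zpowers a := by
      rw [mul_mem_iff_of_index_two hidx, inv_mem_iff]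
      tauto
    obtain ⟨j, hj⟩ := mem_powers_iff_mem_zpowers.2 h1
    exact ⟨j, by rw [show a ^ j = g * x⁻¹ from hj, inv_mul_cancel_right]⟩
  have hx2A : x ^ 2 ∈ zpowers a := by
    rw [sq, mul_mem_iff_of_index_two hidx]
  -- `u ^ 2 ≡ 1` and `u ≡ 3` modulo `4` force `u ≡ -1` modulo half the order of `a`.
  obtain ⟨w, hw⟩ : 2 ^ (m + 1) ∣ u + 1 := by
    have h1 := (Nat.modEq_iff_dvd.1 (modEq_one_of_pow_mem hu hx2A).symm)
    obtain ⟨v, hv⟩ : ∃ v, u = 4 * v + 3 := ⟨u / 4, by omega⟩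
    rw [ha, hv] at h1
    have h2 : ((2 : ℤ) ^ (m + 1)) * 2 ∣ ((2 * v + 1) * (4 * v + 4)) * 2 := by
      have h3 : (((4 * v + 3) ^ 2 : ℕ) : ℤ) - (1 : ℕ) = ((2 * v + 1) * (4 * v + 4)) * 2 := by
        push_cast; ring
      rw [h3] at h1
      rw [← pow_succ]
      exact_mod_cast h1
    have h4 := Int.dvd_of_mul_dvd_mul_right (by norm_num) h2
    have h5 : 2 ^ (m + 1) ∣ (2 * v + 1) * (4 * v + 4) := by exact_mod_cast h4
    have h6 : Nat.Coprime (2 ^ (m + 1)) (2 * v + 1) :=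
      Nat.Coprime.pow_left _ (by simp)
    have h7 := h6.dvd_of_dvd_mul_left h5
    rwa [hv]
  have hnorm : ∀ j : ℕ, (a ^ j * x) ^ 2 = z ^ (w * j) * x ^ 2 := by
    intro j
    have h1 : x * a ^ j = (a ^ j) ^ u * x := by
      have h2 : x * a ^ j = (a ^ u) ^ j * x :=
        SemiconjBy.pow_right (show SemiconjBy x a (a ^ u) from hu) _
      rw [h2, pow_right_comm]
    rw [mul_pow_of_semiconj h1, Finset.sum_range_succ, Finset.sum_range_one, pow_zero, pow_one,
      add_comm 1 u, hw, hz, ← pow_mul, ← pow_mul]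
    congr 2
    ring
  have hx2 : x ^ 2 = 1 ∨ x ^ 2 = z := by
    obtain ⟨i, hi⟩ := mem_powers_iff_mem_zpowers.2 hx2A
    change a ^ i = x ^ 2 at hi
    have h1 : a ^ i = a ^ (u * i) := by
      have h2 : x * a ^ i = (a ^ u) ^ i * x :=
        SemiconjBy.pow_right (show SemiconjBy x a (a ^ u) from hu) _
      have h3 : x * a ^ i = a ^ i * x := by rw [hi]; exact ((Commute.refl x).pow_right 2).eq
      rw [pow_mul]
      exact mul_right_cancel (h3.symm.trans h2)
    have h2 := Nat.modEq_iff_dvd.1 (pow_eq_pow_iff_modEq.1 h1)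
    obtain ⟨v, hv⟩ : ∃ v, u = 4 * v + 3 := ⟨u / 4, by omega⟩
    have h3 : ((2 : ℤ) ^ (m + 1)) * 2 ∣ ((2 * v + 1) * i) * 2 := by
      have h4 : ((u * i : ℕ) : ℤ) - (i : ℕ) = ((2 * v + 1) * i) * 2 := by
        rw [hv]; push_cast; ring
      rw [h4, ha] at h2
      rw [← pow_succ]
      exact_mod_cast h2
    have h4 := Int.dvd_of_mul_dvd_mul_right (by norm_num) h3
    have h5 : 2 ^ (m + 1) ∣ (2 * v + 1) * i := by exact_mod_cast h4
    have h6 : Nat.Coprime (2 ^ (m + 1)) (2 * v + 1) := Nat.Coprime.pow_left _ (by simp)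
    obtain ⟨l, rfl⟩ := h6.dvd_of_dvd_mul_left h5
    rw [← hi, pow_mul, ← hz]
    rcases Nat.even_or_odd' l with ⟨n, rfl | rfl⟩
    · left; rw [pow_mul, hz2, one_pow]
    · right; rw [pow_succ, pow_mul, hz2, one_pow, one_mul]
  have hord4 : ∀ g : G, g ^ 2 = z → orderOf g = 4 := by
    intro g hg
    refine orderOf_eq_prime_pow (p := 2) (n := 1) (by simpa [hg] using hz1) ?_
    rw [show 2 ^ (1 + 1) = 2 * 2 from rfl, pow_mul, hg, hz2]
  have hord2 : ∀ g : G, g ∉ zpowers a → g ^ 2 = 1 → orderOf g = 2 := fun g hg h =>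
    orderOf_eq_prime h fun h1 => hg (h1 ▸ one_mem _)
  have hcardout : ((Finset.univ.filter (· ∉ zpowers a)).card : ℚ) = 4 * 2 ^ m := by
    have h1 : (Finset.univ.filter (· ∈ zpowers a)).card = 2 ^ (m + 2) := by
      rw [← ha, ← Nat.card_zpowers]
      exact (Nat.subtype_card _ (by simp)).symm
    have h2 := Finset.card_filter_add_card_filter_not (s := (Finset.univ : Finset G))
      (· ∈ zpowers a)
    rw [h1, Finset.card_univ, Fintype.card_eq_nat_card, ← card_mul_index (zpowers a), hidx,
      Nat.card_zpowers, ha] at h2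
    have h3 : (Finset.univ.filter (· ∉ zpowers a)).card = 4 * 2 ^ m := by
      rw [pow_add] at h2; omega
    exact_mod_cast h3
  rcases Nat.even_or_odd' w with ⟨v, hv | hv⟩
  · -- The square is constant outside `⟨a⟩`.
    have hsq : ∀ g, g ∉ zpowers a → g ^ 2 = x ^ 2 := by
      intro g hg
      obtain ⟨j, rfl⟩ := hout g hg
      rw [hnorm, hv, mul_assoc, pow_mul, hz2, one_pow, one_mul]
    have hconst : ∀ c : ℕ, (∀ g, g ∉ zpowers a → orderOf g = c) →
        ∑ g with g ∉ zpowers a, 1 / (orderOf g : ℚ) = 4 * 2 ^ m / c := by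
      intro c h
      rw [Finset.sum_congr rfl (g := fun _ => 1 / (c : ℚ)), Finset.sum_const, nsmul_eq_mul,
        hcardout]
      · ring
      · intro g hg
        rw [h g (by simpa using hg)]
    rcases hx2 with h | h
    · obtain ⟨r, hr⟩ := exists_eq_two_pow (c := 4) ha hidx (by
        rw [hconst 2 fun g hg => hord2 g hg ((hsq g hg).trans h)]
        norm_num) hk
      have hm : m = 0 := by
        by_contra hm
        exact add_add_two_pow_ne_of_four m r hm hr
      subst hm
      have ha4 : orderOf a = 4 := ha
      refine nonempty_mulEquiv_dihedralGroup_four ?_ ha4 h hx ?_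
      · rw [← card_mul_index (zpowers a), hidx, Nat.card_zpowers, ha4]
      · rw [hu, ← pow_mod_orderOf, ha4, hu4]
        congr 1
        rw [eq_inv_iff_mul_eq_one, ← pow_succ]
        have h4 := pow_orderOf_eq_one a
        rwa [ha4] at h4
    · obtain ⟨r, hr⟩ := exists_eq_two_pow (c := 2) ha hidx (by
        rw [hconst 4 fun g hg => hord4 g ((hsq g hg).trans h)]
        push_cast
        ring) hk
      exact absurd hr (add_add_two_pow_ne_of_two m r)
  · -- Multiplication by `a` changes the square by `z`.
    have hm : m ≠ 0 := by
      rintro rfl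
      omega
    have hzw : z ^ w = z := by rw [hv, pow_succ, pow_mul, hz2, one_pow, one_mul]
    have hamem : ∀ g, a * g ∉ zpowers a ↔ g ∉ zpowers a := fun g =>
      (mul_mem_cancel_left (mem_zpowers a)).not
    have hpair : ∀ g ∈ Finset.univ.filter (· ∉ zpowers a),
        1 / (orderOf g : ℚ) + 1 / (orderOf (a * g) : ℚ) = 3 / 4 := by
      intro g hg
      have hgA : g ∉ zpowers a := by simpa using hg
      have hagA := (hamem g).2 hgA
      obtain ⟨j, hj⟩ := hout g hgA
      have hstep : (a * g) ^ 2 = z * g ^ 2 := by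
        rw [hj, ← mul_assoc, ← pow_succ', hnorm, hnorm, pow_mul, pow_mul, hzw, pow_succ', mul_assoc]
      have hg2 : g ^ 2 = 1 ∨ g ^ 2 = z := by
        rw [hj, hnorm, pow_mul, hzw]
        rcases Nat.even_or_odd' j with ⟨n, rfl | rfl⟩
        · rwa [pow_mul, hz2, one_pow, one_mul]
        · rw [pow_succ, pow_mul, hz2, one_pow, one_mul]
          rcases hx2 with h | h
          · right; rw [h, mul_one]
          · left; rw [h, ← sq, hz2]
      rcases hg2 with h | h
      · rw [hord2 g hgA h, hord4 (a * g) (by rw [hstep, h, mul_one])]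
        norm_num
      · rw [hord4 g h, hord2 (a * g) hagA (by rw [hstep, h, ← sq, hz2])]
        norm_num
    have hshift : ∑ g with g ∉ zpowers a, 1 / (orderOf (a * g) : ℚ) =
        ∑ g with g ∉ zpowers a, 1 / (orderOf g : ℚ) := by
      refine Finset.sum_equiv (Equiv.mulLeft a) (fun g => ?_) fun g _ => rfl
      simp only [Finset.mem_filter, Finset.mem_univ, true_and, Equiv.coe_mulLeft]
      exact (hamem g).symm
    have hsum := Finset.sum_congr rfl hpair
    rw [Finset.sum_add_distrib, hshift, Finset.sum_const, nsmul_eq_mul, hcardout] at hsum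
    obtain ⟨r, hr⟩ := exists_eq_two_pow (c := 3) ha hidx (by push_cast; linarith) hk
    exact absurd hr (add_add_two_pow_ne_of_three m r hm)

/-! ### The classification -/

theorem mainTheorem1 {G : Type*} [Group G] [Fintype G] [Nontrivial G]
    (p : ℕ) (hp : p.Prime) (hG : IsPGroup p G) :
    (∃ k : ℕ, harmonicMeanOrders G = (k : ℚ)) ↔
      ((IsCyclic G ∧ ∃ s : ℕ, 1 ≤ s ∧ Fintype.card G = p ^ (∑ i ∈ Finset.Icc 1 s, p ^ i)) ∨
        Nonempty (G ≃* DihedralGroup 4)) := by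
  by_cases hc : IsCyclic G
  · rw [harmonicMeanOrders_isCyclic_iff hp hG]
    refine ⟨fun h => Or.inl ⟨hc, h⟩, ?_⟩
    rintro (⟨-, h⟩ | ⟨⟨e⟩⟩)
    · exact h
    · exact absurd (isCyclic_of_surjective e e.surjective)
        (DihedralGroup.not_isCyclic (by norm_num))
  · constructor
    · rintro ⟨k, hk⟩
      right
      by_cases hp2 : p = 2
      · subst hp2
        rcases isCyclic_or_exists_isNormalRankTwo_or hG with h | ⟨z, x, h⟩ |
          ⟨a, x, m, u, ha, hidx, hx, hu, hu4⟩
        · exact absurd h hc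
        · exact h.nonempty_mulEquiv_of_natCast hG hk
        · exact nonempty_mulEquiv_dihedralGroup_of_index_two ha hidx hx hu hu4 hk
      · rcases isCyclic_or_exists_isNormalRankTwo hp hp2 hG with h | ⟨z, x, h⟩
        · exact absurd h hc
        · exact absurd hk (h.harmonicMeanOrders_ne_natCast_of_odd hp hp2 hG k)
    · rintro (⟨h, -⟩ | ⟨⟨e⟩⟩)
      · exact absurd h hc
      · exact ⟨2, by rw [harmonicMeanOrders_congr e, harmonicMeanOrders_dihedralGroup_four]; rfl⟩
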